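/- Let $\langle x,y\rangle=-x_0y_0+x_1y_1+x_2y_2+x_3y_3$ on $\mathbb R^{3,1}$ and $\mathbb H^3=\{\langle x,x\rangle=-1,\ x_0>0\}$. A generalised (mildly truncated) hyperbolic tetrahedron $T$ is given by linearly independent vertices $v_1,\dots,v_4\in\mathbb R^{3,1}$ of types $\varepsilon_i\in\{1,0,-1\}$ (proper, ideal, ultra-ideal), with $\langle v_i,v_i\rangle=-\varepsilon_i$, and for $i\ne j$: $\langle v_i,v_j\rangle<0$; $\langle v_i,v_j\rangle<-1$ if $\varepsilon_i=\varepsilon_j=-1$ (the truncating polar planes neither meet nor touch); and $v_i+v_j$ is future-directed. Let $a_{ij}\in(0,\pi)$ be the dihedral angle at the edge $e_{ij}$ and, if $\varepsilon_i,\varepsilon_j\neq0$, let $\ell_{ij}$ be the length of the truncated edge $e_{ij}$, which ends at $v_i$ if $\varepsilon_i=1$ and at the polar plane of $v_i$ if $\varepsilon_i=-1$ (similarly at $v_j$). Write $a=(a_{12},a_{13},a_{14},a_{23},a_{24},a_{34})$, $\ell=(\ell_{12},\ell_{13},\ell_{14},\ell_{23},\ell_{24},\ell_{34})$. Let $G$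 be the Gram matrix: its diagonal entries are $1$ and, for $\{i,j,k,l\}=\{1,2,3,4\}$ the entry in row $i$, column $j$ is $-\cos a_{kl}$. Let $G_{ii}$ denote $G$ without its $i$-th row and column. **Theorem.** In a neighbourhood $U$ of the angles $a(T)$ in $\mathbb R^6$ every $a$ is the angle vector of some generalised hyperbolic tetrahedron; all tetrahedra $T'$ with angles in $U$ have the same types as $T$ at the non-ideal vertices of $T$; and each length $\ell_{kl}$ with $\varepsilon_k,\varepsilon_l\ne0$ is a function of $a$ on $U$. (a) If no vertex of $T$ is ideal, $\ell$ is differentiable as a function of $a$ at $a(T)$, and $$\mathrm{Jac}^\star(T)=\frac{\partial(\ell_{12},\ell_{13},\ell_{14},\ell_{23},\ell_{24},\ell_{34})}{\partial(a_{12},a_{13},a_{14},a_{23},a_{24},a_{34})}=-\eta\,\mathscr D\mathscr S\mathscr D,$$ where $\sigma_{kl}=\frac12e^{\ell_{kl}}-\frac12\varepsilon_k\varepsilon_le^{-\ell_{kl}}$, $\sigma'_{kl}=\frac12e^{\ell_{kl}}+\frac12\varepsilon_k\varepsilon_le^{-\ell_{kl}}$, $\mathscr D=\mathrm{diag}(\sigma_{12},\sigma_{13},\sigma_{14},\sigma_{23},\sigma_{24},\sigma_{34})$,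 $$\eta=\left(\frac{\prod_{i=1}^4\varepsilon_i\det G_{ii}}{(-\det G)^3}\right)^{1/2},$$ $$\mathscr S=\begin{pmatrix} \omega_{12}&\varepsilon_1\sigma'_{14}&\varepsilon_1\sigma'_{13}&\varepsilon_2\sigma'_{24}&\varepsilon_2\sigma'_{23}&1\\ \varepsilon_1\sigma'_{14}&\omega_{13}&\varepsilon_1\sigma'_{12}&\varepsilon_3\sigma'_{34}&1&\varepsilon_3\sigma'_{23}\\ \varepsilon_1\sigma'_{13}&\varepsilon_1\sigma'_{12}&\omega_{14}&1&\varepsilon_4\sigma'_{34}&\varepsilon_4\sigma'_{24}\\ \varepsilon_2\sigma'_{24}&\varepsilon_3\sigma'_{34}&1&\omega_{23}&\varepsilon_2\sigma'_{12}&\varepsilon_3\sigma'_{13}\\ \varepsilon_2\sigma'_{23}&1&\varepsilon_4\sigma'_{34}&\varepsilon_2\sigma'_{12}&\omega_{24}&\varepsilon_4\sigma'_{14}\\ 1&\varepsilon_3\sigma'_{23}&\varepsilon_4\sigma'_{24}&\varepsilon_3\sigma'_{13}&\varepsilon_4\sigma'_{14}&\omega_{34}\end{pmatrix},$$ and, for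 $\{i,j,k,l\}=\{1,2,3,4\}$, $$\omega_{kl}=\frac{-\sigma'_{ik}\sigma'_{jl}+\varepsilon_l\sigma'_{il}\sigma'_{jl}\sigma'_{kl}-\sigma'_{il}\sigma'_{jk}+\varepsilon_k\sigma'_{ik}\sigma'_{jk}\sigma'_{kl}}{\sigma_{kl}^2}.$$ (b) If $T$ is arbitrary (ideal vertices allowed), then for every edge $e_{kl}$ with $\varepsilon_k,\varepsilon_l\neq0$ the length $\ell_{kl}$ is differentiable as a function of $a$ at $a(T)$, and its six partial derivatives there are the limits of the entries of the $(kl)$-row of $-\eta\,\mathscr D\mathscr S\mathscr D$, taken at tetrahedra $T'$ without ideal vertices, as $a(T')\to a(T)$. -/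

import Mathlib

open Filter Topology

noncomputable section

/-- Minkowski space `ℝ^{3,1}`; the coordinate with index `0` is the time-like one. -/
abbrev Mink : Type := Fin 4 → ℝ

/-- The Lorentzian form of signature `(3,1)`. -/
def mink (x y : Mink) : ℝ := -(x 0 * y 0) + x 1 * y 1 + x 2 * y 2 + x 3 * y 3

/-- The distance of two points of `ℍ³ = {x | ⟨x,x⟩ = -1, 0 < x 0}`: `cosh d(x,y) = -⟨x,y⟩`. -/
def hypDist (x y : Mink) : ℝ := Real.arcosh (-mink x y)

/-- A generalised (mildly truncated) hyperbolic tetrahedron, in the hyperboloid model.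

The vertex `v i` is given by a vector of Minkowski space: a point of `ℍ³` if it is proper
(`kind i = 1`), a future light-like vector (spanning a point of `∂ℍ³`) if it is ideal
(`kind i = 0`), and a unit space-like vector, with polar plane `{x ∈ ℍ³ | ⟨x, v i⟩ = 0}`,
if it is ultra-ideal (`kind i = -1`). -/
structure GenTetrahedron where
  /-- the vertices -/
  v : Fin 4 → Mink
  /-- the types of the vertices -/
  kind : Fin 4 → SignType
  mink_self : ∀ i, mink (v i) (v i) = -(kind i : ℝ)
  /-- the tetrahedron is not degenerate -/
  indep : LinearIndependent ℝ v
  /-- every vertex which is not cut off by the polar plane of the ultra-ideal vertex `v i` lies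
  strictly on the far side of that plane; for two vertices which are not ultra-ideal this says
  that they lie on the same light cone -/
  mink_neg : ∀ i j, i ≠ j → mink (v i) (v j) < 0
  /-- mild truncation: the polar planes of two ultra-ideal vertices neither meet nor touch -/
  mild : ∀ i j, i ≠ j → kind i = -1 → kind j = -1 → mink (v i) (v j) < -1
  /-- every edge passes through `ℍ³` (its time-like vector `v i + v j` points to the future) -/
  future : ∀ i j, i ≠ j → 0 < v i 0 + v j 0

namespace GenTetrahedron

variable (T : GenTetrahedron)

/-- The number `ε_i ∈ {1, 0, -1}`: proper, ideal, ultra-ideal. -/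
def eps (i : Fin 4) : ℝ := (T.kind i : ℝ)

/-- The end at `v i` of the truncated edge `e_ij`: the vertex `v i` itself if it is proper, and
the point where the line through `v i`, `v j` meets the polar plane of `v i` if `v i` is
ultra-ideal (not used for an ideal `v i`). -/
def edgeEnd (i j : Fin 4) : Mink :=
  if T.kind i = 1 then T.v i
  else
    let w : Mink := T.v j - mink (T.v i) (T.v j) • T.v i
    (Real.sqrt (-mink w w))⁻¹ • w

/-- The length `ℓ_ij` of the (truncated) edge `e_ij` (used if `v i` and `v j` are not ideal). -/
def len (i j : Fin 4) : ℝ := hypDist (T.edgeEnd i j) (T.edgeEnd j i)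

/-- The Lorentzian dual basis of the basis of vertices. -/
def dualVec (i : Fin 4) : Mink :=
  fun m => (if m = 0 then -1 else 1) * ((Matrix.of T.v)⁻¹ : Matrix (Fin 4) (Fin 4) ℝ) m i

theorem mink_dualVec (i j : Fin 4) : mink (T.dualVec i) (T.v j) = if i = j then 1 else 0 := by
  have hu : IsUnit (Matrix.of T.v : Matrix (Fin 4) (Fin 4) ℝ) :=
    Matrix.linearIndependent_rows_iff_isUnit.mp T.indep
  have h := congrFun (congrFun (Matrix.mul_nonsing_inv (Matrix.of T.v)
    ((Matrix.isUnit_iff_isUnit_det _).mp hu)) j) i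
  rw [Matrix.mul_apply, Fin.sum_univ_four, Matrix.one_apply] at h
  simp only [Matrix.of_apply] at h
  have e : mink (T.dualVec i) (T.v j) = if j = i then 1 else 0 := by
    rw [← h]
    simp [mink, dualVec]
    ring
  rw [e]
  simp [eq_comm]

/-- The outward unit normal of the face opposite to `v i`: it is orthogonal to the other three
vertices, and `⟨normal i, v i⟩ < 0`. -/
def normal (i : Fin 4) : Mink :=
  (-(Real.sqrt (mink (T.dualVec i) (T.dualVec i)))⁻¹) • T.dualVec i

/-- The interior dihedral angle between the faces opposite to `v i` and `v j`, that is, along the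
edge which joins the other two vertices. -/
def faceAngle (i j : Fin 4) : ℝ := Real.arccos (-mink (T.normal i) (T.normal j))

end GenTetrahedron

/-- The edges `12, 13, 14, 23, 24, 34` (vertices are numbered from `0` in the code): the first
endpoint. The edge opposite to the edge `e` is `e.rev`. -/
def edgeFst : Fin 6 → Fin 4 := ![0, 0, 0, 1, 1, 2]

/-- The second endpoint of an edge. -/
def edgeSnd : Fin 6 → Fin 4 := ![1, 2, 3, 2, 3, 3]

namespace GenTetrahedron

variable (T : GenTetrahedron)

/-- The edge lengths `(ℓ₁₂, ℓ₁₃, ℓ₁₄, ℓ₂₃, ℓ₂₄, ℓ₃₄)`. -/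
def lengths : Fin 6 → ℝ := fun e => T.len (edgeFst e) (edgeSnd e)

/-- The dihedral angles `(a₁₂, a₁₃, a₁₄, a₂₃, a₂₄, a₃₄)`: the two faces which meet along an edge
are opposite to the endpoints of the opposite edge. -/
def angles : Fin 6 → ℝ := fun e => T.faceAngle (edgeFst e.rev) (edgeSnd e.rev)

/-- No vertex is ideal. -/
def NoIdeal : Prop := ∀ i, T.kind i ≠ 0

/-- The endpoints of the edge `e` are not ideal. -/
def EdgeNoIdeal (e : Fin 6) : Prop := T.kind (edgeFst e) ≠ 0 ∧ T.kind (edgeSnd e) ≠ 0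

/-- The Gram matrix. -/
def gram : Matrix (Fin 4) (Fin 4) ℝ :=
  let c : Fin 6 → ℝ := fun e => -Real.cos (T.angles e)
  !![1, c 5, c 4, c 3;
     c 5, 1, c 2, c 1;
     c 4, c 2, 1, c 0;
     c 3, c 1, c 0, 1]

/-- `G_ii`: the Gram matrix without its `i`-th row and column. -/
def gramMinor (i : Fin 4) : Matrix (Fin 3) (Fin 3) ℝ :=
  T.gram.submatrix i.succAbove i.succAbove

/-- `η`. -/
def eta : ℝ :=
  Real.sqrt ((∏ i, T.eps i * (T.gramMinor i).det) / (-T.gram.det) ^ 3)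

/-- `σ_kl = ½ e^ℓ - ½ ε_k ε_l e^{-ℓ}`. -/
def sig (k l : Fin 4) : ℝ :=
  1 / 2 * Real.exp (T.len k l) - 1 / 2 * T.eps k * T.eps l * Real.exp (-T.len k l)

/-- `σ'_kl = ½ e^ℓ + ½ ε_k ε_l e^{-ℓ}`. -/
def sig' (k l : Fin 4) : ℝ :=
  1 / 2 * Real.exp (T.len k l) + 1 / 2 * T.eps k * T.eps l * Real.exp (-T.len k l)

/-- `ω_kl`, where `i`, `j` are the other two vertices. -/
def omega (k l i j : Fin 4) : ℝ :=
  (-(T.sig' i k * T.sig' j l) + T.eps l * T.sig' i l * T.sig' j l * T.sig' k l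
    - T.sig' i l * T.sig' j k + T.eps k * T.sig' i k * T.sig' j k * T.sig' k l) / T.sig k l ^ 2

/-- The diagonal matrix `D`. -/
def matD : Matrix (Fin 6) (Fin 6) ℝ :=
  Matrix.diagonal fun e => T.sig (edgeFst e) (edgeSnd e)

/-- The symmetric matrix `S`. -/
def matS : Matrix (Fin 6) (Fin 6) ℝ :=
  let ε := T.eps
  let s := T.sig'
  let ω := T.omega
  !![ω 0 1 2 3, ε 0 * s 0 3, ε 0 * s 0 2, ε 1 * s 1 3, ε 1 * s 1 2, 1;
     ε 0 * s 0 3, ω 0 2 1 3, ε 0 * s 0 1, ε 2 * s 2 3, 1, ε 2 * s 1 2;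
     ε 0 * s 0 2, ε 0 * s 0 1, ω 0 3 1 2, 1, ε 3 * s 2 3, ε 3 * s 1 3;
     ε 1 * s 1 3, ε 2 * s 2 3, 1, ω 1 2 0 3, ε 1 * s 0 1, ε 2 * s 0 2;
     ε 1 * s 1 2, 1, ε 3 * s 2 3, ε 1 * s 0 1, ω 1 3 0 2, ε 3 * s 0 3;
     1, ε 2 * s 1 2, ε 3 * s 1 3, ε 2 * s 0 2, ε 3 * s 0 3, ω 2 3 0 1]

/-- The matrix `-η D S D`. -/
def jacMatrix : Matrix (Fin 6) (Fin 6) ℝ := -(T.eta • (T.matD * T.matS * T.matD))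

end GenTetrahedron

end

/-! Up to the factors −s_i, where s_i = `scale i` > 0, the vertices form the Lorentzian dual basis
of the outward normals. Hence the Gram matrix G of the normals, with entries −cos of the angles off
the diagonal, has inverse H with H_ij = s_i s_j ⟨v_i, v_j⟩ (`inv_gramOf`). For an edge with
non-ideal ends, e^ℓ = −⟨v_i, v_j⟩ + σ, where σ² = ⟨v_i, v_j⟩² − ε_i ε_j and σ' = −⟨v_i, v_j⟩.
Written in H_ij, H_ii, H_jj, the scales cancel: ℓ is the function `lenOf` of the angles, which is C¹
even if a vertex off the edge is ideal.

For the Jacobian, dH = −H dG H, and the angle a_f enters only two entries of G, with derivative sin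
a_f. Jacobi's identity for complementary minors turns sin a_f into σ_f times two scales and √(−det
G) (`sin_angles`). The four scales and the root make up η (`eta_eq`), and what remains is a
polynomial in the ⟨v_i, v_j⟩ equal to −σ_e² S_ef (`bracket_eq_matS`). Part (b) is then continuity of
the derivative of a C¹ function.

For existence, near a basis every symmetric matrix close to its Gram matrix is again a Gram matrix
of nearby vectors (`eventually_exists_gram`). Applied to the normals, this yields nearby vertices by
duality. The conditions on the vertices are open once they are stated for rays (`IsPreTetrahedron`),
and rescaling gives a tetrahedron. The type of a vertex is read off from the sign of H_ii. -/

noncomputable section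

/-! ### The Lorentzian form -/

theorem mink_comm (x y : Mink) : mink x y = mink y x := by
  simp only [mink]; ring

theorem mink_add_left (x y z : Mink) : mink (x + y) z = mink x z + mink y z := by
  simp only [mink, Pi.add_apply]; ring

theorem mink_add_right (x y z : Mink) : mink x (y + z) = mink x y + mink x z := by
  simp only [mink, Pi.add_apply]; ring

theorem mink_smul_left (c : ℝ) (x y : Mink) : mink (c • x) y = c * mink x y := by
  simp only [mink, Pi.smul_apply, smul_eq_mul]; ring

theorem mink_smul_right (c : ℝ) (x y : Mink) : mink x (c • y) = c * mink x y := by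
  simp only [mink, Pi.smul_apply, smul_eq_mul]; ring

theorem mink_zero_left (x : Mink) : mink 0 x = 0 := by
  simp [mink]

theorem mink_sum_left {ι : Type*} (s : Finset ι) (f : ι → Mink) (y : Mink) :
    mink (∑ i ∈ s, f i) y = ∑ i ∈ s, mink (f i) y := by
  classical
  induction s using Finset.induction_on with
  | empty => simp [mink]
  | insert a s ha ih => rw [Finset.sum_insert ha, Finset.sum_insert ha, mink_add_left, ih]

/-- A nonzero vector orthogonal to a time-like vector is space-like. -/
theorem mink_self_pos_of_orthogonal {t w : Mink} (ht : mink t t < 0) (h : mink t w = 0)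
    (hw : w ≠ 0) : 0 < mink w w := by
  by_contra! hle
  simp only [mink] at ht h hle
  have hcs : (t 1 * w 1 + t 2 * w 2 + t 3 * w 3) ^ 2
      ≤ (t 1 ^ 2 + t 2 ^ 2 + t 3 ^ 2) * (w 1 ^ 2 + w 2 ^ 2 + w 3 ^ 2) := by
    nlinarith [sq_nonneg (t 1 * w 2 - t 2 * w 1), sq_nonneg (t 1 * w 3 - t 3 * w 1),
      sq_nonneg (t 2 * w 3 - t 3 * w 2)]
  -- By orthogonality the spatial product equals t₀w₀, so t₀²w₀² ≤ |t|²|w|² ≤ |t|²w₀² for the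
  -- spatial parts. As |t|² < t₀², this forces w₀ = 0 and then w = 0.
  have he : t 0 * w 0 = t 1 * w 1 + t 2 * w 2 + t 3 * w 3 := by linarith
  rw [← he] at hcs
  have h1 : (t 1 ^ 2 + t 2 ^ 2 + t 3 ^ 2) * (w 1 ^ 2 + w 2 ^ 2 + w 3 ^ 2)
      ≤ (t 1 ^ 2 + t 2 ^ 2 + t 3 ^ 2) * w 0 ^ 2 := by
    apply mul_le_mul_of_nonneg_left _ (by positivity)
    nlinarith
  have h0 : w 0 ^ 2 ≤ 0 := by
    by_contra! hpos
    nlinarith [mul_lt_mul_of_pos_right (show t 1 ^ 2 + t 2 ^ 2 + t 3 ^ 2 < t 0 ^ 2 by nlinarith) hpos]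
  have hs : w 1 ^ 2 + w 2 ^ 2 + w 3 ^ 2 ≤ 0 := by nlinarith
  apply hw
  funext m
  have : w m ^ 2 ≤ 0 := by
    fin_cases m
    · exact h0
    · change w 1 ^ 2 ≤ 0; nlinarith [sq_nonneg (w 2), sq_nonneg (w 3)]
    · change w 2 ^ 2 ≤ 0; nlinarith [sq_nonneg (w 1), sq_nonneg (w 3)]
    · change w 3 ^ 2 ≤ 0; nlinarith [sq_nonneg (w 2), sq_nonneg (w 1)]
  exact pow_eq_zero_iff two_ne_zero |>.mp (le_antisymm this (sq_nonneg _))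

/-- A causal vector whose product with a future time-like vector is negative is future. -/
theorem future_of_mink_neg {x y : Mink} (hx : mink x x < 0) (hy : mink y y ≤ 0)
    (hxy : mink x y < 0) (h0 : 0 < x 0) : 0 < y 0 := by
  by_contra! hle
  simp only [mink] at hx hy hxy
  have hcs : (x 1 * y 1 + x 2 * y 2 + x 3 * y 3) ^ 2
      ≤ (x 1 ^ 2 + x 2 ^ 2 + x 3 ^ 2) * (y 1 ^ 2 + y 2 ^ 2 + y 3 ^ 2) := by
    nlinarith [sq_nonneg (x 1 * y 2 - x 2 * y 1), sq_nonneg (x 1 * y 3 - x 3 * y 1),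
      sq_nonneg (x 2 * y 3 - x 3 * y 2)]
  have h1 : (x 1 ^ 2 + x 2 ^ 2 + x 3 ^ 2) * (y 1 ^ 2 + y 2 ^ 2 + y 3 ^ 2)
      ≤ x 0 ^ 2 * y 0 ^ 2 := by
    apply mul_le_mul (by nlinarith) (by nlinarith) (by positivity) (by positivity)
  have h2 : x 1 * y 1 + x 2 * y 2 + x 3 * y 3 < x 0 * y 0 := by linarith
  have h3 : x 0 * y 0 ≤ 0 := mul_nonpos_of_nonneg_of_nonpos h0.le hle
  nlinarith

/-- Two time-like positive combinations of vectors with negative product lie in the same cone. -/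
theorem mink_combination_neg {x y : Mink} (hxy : mink x y < 0) {s t s' t' : ℝ} (hs : 0 < s)
    (ht : 0 < t) (hs' : 0 < s') (ht' : 0 < t') (h : mink (s • x + t • y) (s • x + t • y) < 0)
    (h' : mink (s' • x + t' • y) (s' • x + t' • y) < 0) :
    mink (s • x + t • y) (s' • x + t' • y) < 0 := by
  simp only [mink_add_left, mink_add_right, mink_smul_left, mink_smul_right, mink_comm y x]
    at h h' ⊢
  generalize mink x x = p at *
  generalize mink y y = q at *
  generalize mink x y = m at *
  have e1 : s * s * p + t * t * q < -2 * (s * t * m) := by linarith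
  have e2 : s' * s' * p + t' * t' * q < -2 * (s' * t' * m) := by linarith
  -- For q ≥ 0, add s'² times `e1` to s² times `e2`: the q-terms exceed 2ss'tt'q by q(ts' − t's)² ≥
  -- 0, and 2ss' cancels. The case p ≥ 0 is symmetric; if both are negative every term has the right
  -- sign.
  suffices s * s' * p + t * t' * q < -(s * t' + t * s') * m by linarith
  rcases le_or_gt 0 q with hq | hq
  · have hss : 0 < s * s' := mul_pos hs hs'
    have h1 := mul_lt_mul_of_pos_right e1 (pow_pos hs' 2)
    have h2 := mul_lt_mul_of_pos_right e2 (pow_pos hs 2)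
    have h3 := mul_nonneg hq (sq_nonneg (t * s' - t' * s))
    refine lt_of_mul_lt_mul_left ?_ hss.le
    linarith
  rcases le_or_gt 0 p with hp | hp
  · have htt : 0 < t * t' := mul_pos ht ht'
    have h1 := mul_lt_mul_of_pos_right e1 (pow_pos ht' 2)
    have h2 := mul_lt_mul_of_pos_right e2 (pow_pos ht 2)
    have h3 := mul_nonneg hp (sq_nonneg (s * t' - s' * t))
    refine lt_of_mul_lt_mul_left ?_ htt.le
    linarith
  · have := mul_pos (mul_pos hs hs') (neg_pos.2 hp)
    have := mul_pos (mul_pos ht ht') (neg_pos.2 hq)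
    have := mul_pos (show 0 < s * t' + t * s' by positivity) (neg_pos.2 hxy)
    linarith

/-- Reversed Cauchy–Schwarz: the component of y orthogonal to the time-like x is nonzero, hence
space-like. -/
theorem mink_mul_lt_sq {x y : Mink} (hx : mink x x < 0) (h : ∀ c : ℝ, y ≠ c • x) :
    mink x x * mink y y < mink x y ^ 2 := by
  have hw : mink x x • y - mink x y • x ≠ 0 := by
    intro h0
    apply h (mink x y / mink x x)
    have := sub_eq_zero.1 h0
    rw [div_eq_inv_mul, mul_smul, ← this, smul_smul, inv_mul_cancel₀ hx.ne, one_smul]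
  have := mink_self_pos_of_orthogonal hx (w := mink x x • y - mink x y • x) (by
    rw [sub_eq_add_neg, ← neg_smul, mink_add_right, mink_smul_right, mink_smul_right]; ring) hw
  rw [sub_eq_add_neg, ← neg_smul] at this
  simp only [mink_add_left, mink_add_right, mink_smul_left, mink_smul_right, mink_comm y x] at this
  nlinarith

/-! ### Dual bases -/

/-- The Lorentzian dual basis. -/
def dualBasis (v : Fin 4 → Mink) (i : Fin 4) : Mink :=
  fun m => (if m = 0 then -1 else 1) * ((Matrix.of v)⁻¹ : Matrix (Fin 4) (Fin 4) ℝ) m i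

theorem mink_dualBasis {v : Fin 4 → Mink} (hv : (Matrix.of v).det ≠ 0) (i j : Fin 4) :
    mink (dualBasis v i) (v j) = if i = j then 1 else 0 := by
  have h := congrFun (congrFun (Matrix.mul_nonsing_inv (Matrix.of v) (isUnit_iff_ne_zero.2 hv)) j) i
  rw [Matrix.mul_apply, Fin.sum_univ_four, Matrix.one_apply] at h
  simp only [Matrix.of_apply] at h
  have e : mink (dualBasis v i) (v j) = if j = i then 1 else 0 := by
    rw [← h]
    simp [mink, dualBasis]
    ring
  rw [e]
  simp [eq_comm]

theorem det_of_ne_zero_iff {v : Fin 4 → Mink} :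
    (Matrix.of v).det ≠ 0 ↔ LinearIndependent ℝ v := by
  rw [← isUnit_iff_ne_zero, ← Matrix.isUnit_iff_isUnit_det,
    ← Matrix.linearIndependent_rows_iff_isUnit]
  rfl

/-- A vector is determined by its products with a basis. -/
theorem eq_of_mink_eq {v : Fin 4 → Mink} (hv : (Matrix.of v).det ≠ 0) {x y : Mink}
    (h : ∀ j, mink x (v j) = mink y (v j)) : x = y := by
  have hinj := Matrix.mulVec_injective_of_isUnit
    ((Matrix.isUnit_iff_isUnit_det _).2 (isUnit_iff_ne_zero.2 hv))
  have : (fun m => (if m = 0 then -1 else 1) * x m) =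
      (fun m : Fin 4 => (if m = 0 then -1 else (1 : ℝ)) * y m) := by
    apply hinj
    funext j
    have := h j
    simp [Matrix.mulVec, dotProduct, Fin.sum_univ_four, mink] at this ⊢
    linarith
  funext m
  have := congrFun this m
  split_ifs at this <;> linarith

theorem linearIndependent_of_mink {v u : Fin 4 → Mink} {c : Fin 4 → ℝ} (hc : ∀ i, c i ≠ 0)
    (h : ∀ i j, mink (v i) (u j) = if i = j then c i else 0) : LinearIndependent ℝ v := by
  rw [Fintype.linearIndependent_iff]
  intro g hg j
  have := congrArg (fun x => mink x (u j)) hg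
  simp only [mink_sum_left, mink_smul_left, h, mink_zero_left] at this
  simpa [hc j] using this

/-- The determinant of a Gram matrix. -/
theorem det_mink (v : Fin 4 → Mink) :
    (Matrix.of fun i j => mink (v i) (v j)).det = -(Matrix.of v).det ^ 2 := by
  have : (Matrix.of fun i j => mink (v i) (v j)) =
      Matrix.of v * (Matrix.diagonal (fun m : Fin 4 => if m = 0 then (-1 : ℝ) else 1) *
        (Matrix.of v).transpose) := by
    ext i j
    simp [Matrix.mul_apply, Fin.sum_univ_four, mink]
  rw [this, Matrix.det_mul, Matrix.det_mul, Matrix.det_diagonal, Matrix.det_transpose]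
  simp
  ring

namespace GenTetrahedron

variable (T : GenTetrahedron)

/-! ### Vertices -/

theorem kind_cases (i : Fin 4) : T.kind i = 1 ∨ T.kind i = 0 ∨ T.kind i = -1 := by
  rcases T.kind i with _ | _ | _
  · exact Or.inr (Or.inl rfl)
  · exact Or.inr (Or.inr rfl)
  · exact Or.inl rfl

theorem eps_of_kind_one {i : Fin 4} (h : T.kind i = 1) : T.eps i = 1 := by simp [eps, h]

theorem eps_of_kind_zero {i : Fin 4} (h : T.kind i = 0) : T.eps i = 0 := by simp [eps, h]

theorem eps_of_kind_neg_one {i : Fin 4} (h : T.kind i = -1) : T.eps i = -1 := by simp [eps, h]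

theorem mink_v_self (i : Fin 4) : mink (T.v i) (T.v i) = -T.eps i := T.mink_self i

theorem eps_sq {i : Fin 4} (h : T.kind i ≠ 0) : T.eps i ^ 2 = 1 := by
  rcases T.kind_cases i with h' | h' | h'
  · simp [T.eps_of_kind_one h']
  · exact absurd h' h
  · simp [T.eps_of_kind_neg_one h']

theorem eps_ne_zero {i : Fin 4} (h : T.kind i ≠ 0) : T.eps i ≠ 0 := by
  intro h0
  have := T.eps_sq h
  simp [h0] at this

theorem v_ne_smul {i j : Fin 4} (hij : i ≠ j) (c : ℝ) : T.v j ≠ c • T.v i := by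
  intro h
  have h1 := T.mink_dualVec j j
  rw [h, mink_smul_right, T.mink_dualVec, if_neg hij.symm] at h1
  simp at h1

/-- An ideal and an ultra-ideal vertex are excluded: their sum has square 1 + 2⟨v_i, v_j⟩, whose
sign depends on the scaling of the light-like vector. -/
theorem mink_add_v_neg {i j : Fin 4} (hij : i ≠ j) (h : ¬(T.kind i = 0 ∧ T.kind j = -1))
    (h' : ¬(T.kind j = 0 ∧ T.kind i = -1)) : mink (T.v i + T.v j) (T.v i + T.v j) < 0 := by
  have hm := T.mink_neg i j hij
  have hmild := T.mild i j hij
  simp only [mink_add_left, mink_add_right, mink_v_self, mink_comm (T.v j) (T.v i)]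
  rcases T.kind_cases i with hi | hi | hi <;> rcases T.kind_cases j with hj | hj | hj <;>
    simp only [hi, hj, eps_of_kind_one, eps_of_kind_zero, eps_of_kind_neg_one] at * <;>
    first
      | linarith
      | (have := hmild trivial trivial; linarith)
      | simp at h h'

/-- The light-like vector is compared with a future time-like sum of two vertices: itself and a
vertex that is not ultra-ideal, or, if there is none, two of the ultra-ideal ones. -/
theorem future_of_ideal {i : Fin 4} (hi : T.kind i = 0) : 0 < T.v i 0 := by
  have hself : mink (T.v i) (T.v i) ≤ 0 := by simp [mink_v_self, T.eps_of_kind_zero hi]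
  by_cases h : ∃ k, k ≠ i ∧ T.kind k ≠ -1
  · obtain ⟨k, hk, hk'⟩ := h
    refine future_of_mink_neg (x := T.v i + T.v k)
      (T.mink_add_v_neg hk.symm (fun h => hk' h.2) (fun h => by simp [hi] at h)) hself ?_
      (T.future i k hk.symm)
    have := T.mink_neg k i hk
    rw [mink_add_left]
    linarith
  · push Not at h
    obtain ⟨k, l, hki, hli, hkl⟩ : ∃ k l : Fin 4, k ≠ i ∧ l ≠ i ∧ k ≠ l := by
      clear h hself hi
      revert i; decide
    refine future_of_mink_neg (x := T.v k + T.v l)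
      (T.mink_add_v_neg hkl (fun h' => by simp [h k hki] at h') (fun h' => by simp [h l hli] at h'))
      hself ?_ (T.future k l hkl)
    have := T.mink_neg k i hki
    have := T.mink_neg l i hli
    rw [mink_add_left]
    linarith

theorem exists_timelike_of_ideal {i j : Fin 4} (hij : i ≠ j) (hi : T.kind i = 0) :
    ∃ c > (0 : ℝ), mink (c • T.v i + T.v j) (c • T.v i + T.v j) < 0 ∧ 0 < (c • T.v i + T.v j) 0 := by
  have hm := T.mink_neg i j hij
  have h0 := T.future_of_ideal hi
  have hfilter : ∀ᶠ c : ℝ in atTop, 0 < c ∧ 0 < T.eps j + c * (-2 * mink (T.v i) (T.v j)) ∧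
      0 < T.v j 0 + c * T.v i 0 :=
    (eventually_gt_atTop 0).and
      (((tendsto_const_nhds.add_atTop (tendsto_id.atTop_mul_const (by linarith))).eventually_gt_atTop
        0).and ((tendsto_const_nhds.add_atTop
          (tendsto_id.atTop_mul_const h0)).eventually_gt_atTop 0))
  obtain ⟨c, hc, h1, h2⟩ := hfilter.exists
  refine ⟨c, hc, ?_, ?_⟩
  · simp only [mink_add_left, mink_add_right, mink_smul_left, mink_smul_right, mink_v_self,
      mink_comm (T.v j) (T.v i), T.eps_of_kind_zero hi]
    linarith
  · simp only [Pi.add_apply, Pi.smul_apply, smul_eq_mul]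
    linarith

/-- Every edge passes through hyperbolic space. -/
theorem exists_timelike {i j : Fin 4} (hij : i ≠ j) :
    ∃ s > (0 : ℝ), ∃ t > (0 : ℝ), mink (s • T.v i + t • T.v j) (s • T.v i + t • T.v j) < 0 ∧
      0 < (s • T.v i + t • T.v j) 0 := by
  by_cases hi : T.kind i = 0
  · obtain ⟨c, hc, h⟩ := T.exists_timelike_of_ideal hij hi
    exact ⟨c, hc, 1, one_pos, by simpa using h⟩
  by_cases hj : T.kind j = 0
  · obtain ⟨c, hc, h⟩ := T.exists_timelike_of_ideal hij.symm hj
    exact ⟨1, one_pos, c, hc, by simpa [add_comm] using h⟩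
  exact ⟨1, one_pos, 1, one_pos, by
    simpa using And.intro (T.mink_add_v_neg hij (fun h => hi h.1) (fun h => hj h.1))
      (T.future i j hij)⟩

/-- This makes σ_ij real and positive. For a proper vertex it is reversed Cauchy–Schwarz, for two
ultra-ideal ones it is mild truncation; otherwise the left side is at most 0. -/
theorem eps_mul_lt_sq {i j : Fin 4} (hij : i ≠ j) :
    T.eps i * T.eps j < mink (T.v i) (T.v j) ^ 2 := by
  have hm := T.mink_neg i j hij
  have hmild := T.mild i j hij
  have hpos : 0 < mink (T.v i) (T.v j) ^ 2 := sq_pos_of_neg hm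
  rcases T.kind_cases i with hi | hi | hi
  · have := mink_mul_lt_sq (x := T.v i) (y := T.v j)
      (by simp [mink_v_self, T.eps_of_kind_one hi]) (T.v_ne_smul hij)
    rw [mink_v_self, mink_v_self] at this
    linarith
  · simpa [T.eps_of_kind_zero hi] using hpos
  rcases T.kind_cases j with hj | hj | hj
  · rw [T.eps_of_kind_neg_one hi, T.eps_of_kind_one hj]; linarith
  · simpa [T.eps_of_kind_zero hj] using hpos
  · rw [T.eps_of_kind_neg_one hi, T.eps_of_kind_neg_one hj]
    nlinarith [hmild hi hj]

/-! ### Faces and dihedral angles -/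

theorem det_v_ne_zero : (Matrix.of T.v).det ≠ 0 := det_of_ne_zero_iff.2 T.indep

theorem dualVec_ne_smul {i j : Fin 4} (hij : i ≠ j) (c : ℝ) : T.dualVec j ≠ c • T.dualVec i := by
  intro h
  have h1 := T.mink_dualVec j j
  rw [h, mink_smul_left, T.mink_dualVec, if_neg hij] at h1
  simp at h1

theorem mink_pos_of_orthogonal_edge {k l : Fin 4} (hkl : k ≠ l) {w : Mink}
    (hk : mink w (T.v k) = 0) (hl : mink w (T.v l) = 0) (hw : w ≠ 0) : 0 < mink w w := by
  obtain ⟨s, -, t, -, h, -⟩ := T.exists_timelike hkl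
  refine mink_self_pos_of_orthogonal h ?_ hw
  rw [mink_comm, mink_add_right, mink_smul_right, mink_smul_right, hk, hl]
  simp

theorem mink_dualVec_self_pos (i : Fin 4) : 0 < mink (T.dualVec i) (T.dualVec i) := by
  obtain ⟨k, l, hki, hli, hkl⟩ : ∃ k l : Fin 4, k ≠ i ∧ l ≠ i ∧ k ≠ l := by
    revert i; decide
  refine T.mink_pos_of_orthogonal_edge hkl ?_ ?_ ?_
  · simp [mink_dualVec, hki.symm]
  · simp [mink_dualVec, hli.symm]
  · intro h
    have := T.mink_dualVec i i
    simp [h, mink_zero_left] at this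

/-- Both vectors are orthogonal to the edge joining the other two vertices, so they span a positive
definite plane, where strict Cauchy–Schwarz holds. This puts the dihedral angle strictly between 0
and π. -/
theorem mink_dualVec_sq_lt {i j : Fin 4} (hij : i ≠ j) :
    mink (T.dualVec i) (T.dualVec j) ^ 2 <
      mink (T.dualVec i) (T.dualVec i) * mink (T.dualVec j) (T.dualVec j) := by
  obtain ⟨k, l, hki, hli, hkj, hlj, hkl⟩ :
      ∃ k l : Fin 4, k ≠ i ∧ l ≠ i ∧ k ≠ j ∧ l ≠ j ∧ k ≠ l := by
    revert i j; decide
  have hi := T.mink_dualVec_self_pos i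
  have := T.mink_pos_of_orthogonal_edge hkl
    (w := mink (T.dualVec i) (T.dualVec i) • T.dualVec j
      + (-mink (T.dualVec i) (T.dualVec j)) • T.dualVec i)
    (by rw [mink_add_left, mink_smul_left, mink_smul_left]; simp [mink_dualVec, hki.symm, hkj.symm])
    (by rw [mink_add_left, mink_smul_left, mink_smul_left]; simp [mink_dualVec, hli.symm, hlj.symm])
    (by
      intro h0
      apply T.dualVec_ne_smul hij
        (mink (T.dualVec i) (T.dualVec j) / mink (T.dualVec i) (T.dualVec i))
      rw [neg_smul, ← sub_eq_add_neg, sub_eq_zero] at h0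
      rw [div_eq_inv_mul, mul_smul, ← h0, smul_smul, inv_mul_cancel₀ hi.ne', one_smul])
  simp only [mink_add_left, mink_add_right, mink_smul_left, mink_smul_right,
    mink_comm (T.dualVec j) (T.dualVec i)] at this
  refine lt_of_mul_lt_mul_left ?_ hi.le
  linarith

/-- The length of the dual vector of a vertex. -/
def scale (i : Fin 4) : ℝ := Real.sqrt (mink (T.dualVec i) (T.dualVec i))

theorem scale_pos (i : Fin 4) : 0 < T.scale i := Real.sqrt_pos.2 (T.mink_dualVec_self_pos i)

theorem scale_sq (i : Fin 4) : T.scale i ^ 2 = mink (T.dualVec i) (T.dualVec i) :=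
  Real.sq_sqrt (T.mink_dualVec_self_pos i).le

theorem normal_eq (i : Fin 4) : T.normal i = (-(T.scale i)⁻¹) • T.dualVec i := rfl

theorem mink_normal_v (i j : Fin 4) :
    mink (T.normal i) (T.v j) = if i = j then -(T.scale i)⁻¹ else 0 := by
  rw [normal_eq, mink_smul_left, mink_dualVec]
  simp

theorem mink_normal_normal (i j : Fin 4) : mink (T.normal i) (T.normal j) =
    mink (T.dualVec i) (T.dualVec j) / (T.scale i * T.scale j) := by
  rw [normal_eq, normal_eq, mink_smul_left, mink_smul_right, div_eq_mul_inv, mul_inv]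
  ring

theorem mink_normal_self (i : Fin 4) : mink (T.normal i) (T.normal i) = 1 := by
  rw [mink_normal_normal, ← scale_sq, sq, div_self]
  exact (mul_pos (T.scale_pos i) (T.scale_pos i)).ne'

theorem mink_normal_sq_lt {i j : Fin 4} (hij : i ≠ j) :
    mink (T.normal i) (T.normal j) ^ 2 < 1 := by
  have := T.mink_dualVec_sq_lt hij
  have hi := T.scale_pos i
  have hj := T.scale_pos j
  rw [← scale_sq, ← scale_sq] at this
  rw [mink_normal_normal, div_pow, div_lt_one (by positivity)]
  linarith

theorem cos_faceAngle {i j : Fin 4} (hij : i ≠ j) :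
    Real.cos (T.faceAngle i j) = -mink (T.normal i) (T.normal j) := by
  have := abs_lt.1 ((sq_lt_one_iff_abs_lt_one _).1 (T.mink_normal_sq_lt hij))
  exact Real.cos_arccos (by linarith) (by linarith)

theorem faceAngle_mem_Ioo {i j : Fin 4} (hij : i ≠ j) : T.faceAngle i j ∈ Set.Ioo 0 Real.pi := by
  have := abs_lt.1 ((sq_lt_one_iff_abs_lt_one _).1 (T.mink_normal_sq_lt hij))
  refine ⟨Real.arccos_pos.2 (by linarith), ?_⟩
  refine lt_of_le_of_ne (Real.arccos_le_pi _) fun h => ?_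
  have := Real.arccos_eq_pi.1 h
  linarith

theorem angles_mem_Ioo (e : Fin 6) : T.angles e ∈ Set.Ioo 0 Real.pi :=
  T.faceAngle_mem_Ioo (by revert e; decide)

theorem cos_angles (e : Fin 6) : Real.cos (T.angles e) =
    -mink (T.normal (edgeFst e.rev)) (T.normal (edgeSnd e.rev)) :=
  T.cos_faceAngle (by revert e; decide)

end GenTetrahedron

/-! ### The Gram matrix of the normals and its inverse -/

/-- The Gram matrix as a function of the dihedral angles. -/
def gramOf (a : Fin 6 → ℝ) : Matrix (Fin 4) (Fin 4) ℝ :=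
  !![1, -Real.cos (a 5), -Real.cos (a 4), -Real.cos (a 3);
     -Real.cos (a 5), 1, -Real.cos (a 2), -Real.cos (a 1);
     -Real.cos (a 4), -Real.cos (a 2), 1, -Real.cos (a 0);
     -Real.cos (a 3), -Real.cos (a 1), -Real.cos (a 0), 1]

theorem gramOf_self (a : Fin 6 → ℝ) (i : Fin 4) : gramOf a i i = 1 := by
  fin_cases i <;> rfl

theorem gramOf_symm (a : Fin 6 → ℝ) (i j : Fin 4) : gramOf a i j = gramOf a j i := by
  fin_cases i <;> fin_cases j <;> rfl

theorem gramOf_edge (a : Fin 6 → ℝ) (e : Fin 6) :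
    gramOf a (edgeFst e.rev) (edgeSnd e.rev) = -Real.cos (a e) := by
  fin_cases e <;> rfl

/-- Jacobi's identity for the complementary minors of a Gram matrix. -/
theorem adjugate_gramOf (a : Fin 6 → ℝ) (e : Fin 6) :
    (gramOf a).adjugate (edgeFst e) (edgeSnd e) ^ 2 -
      (gramOf a).adjugate (edgeFst e) (edgeFst e) * (gramOf a).adjugate (edgeSnd e) (edgeSnd e) =
    -(gramOf a).det * Real.sin (a e) ^ 2 := by
  rw [Real.sin_sq]
  simp only [Matrix.adjugate_fin_succ_eq_det_submatrix, Matrix.det_fin_three,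
    Matrix.det_succ_row_zero (gramOf a), Fin.sum_univ_four, Matrix.submatrix_apply]
  fin_cases e <;>
    simp [gramOf, edgeFst, edgeSnd, Fin.succAbove, Fin.lt_def] <;> ring

namespace GenTetrahedron

variable (T : GenTetrahedron)

theorem gram_eq_gramOf : T.gram = gramOf T.angles := rfl

theorem gramOf_angles (i j : Fin 4) :
    gramOf T.angles i j = mink (T.normal i) (T.normal j) := by
  have h : ∀ e : Fin 6, -Real.cos (T.angles e) =
      mink (T.normal (edgeFst e.rev)) (T.normal (edgeSnd e.rev)) := fun e => by
    rw [cos_angles, neg_neg]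
  have h' : ∀ e : Fin 6, -Real.cos (T.angles e) =
      mink (T.normal (edgeSnd e.rev)) (T.normal (edgeFst e.rev)) := fun e => by
    rw [h, mink_comm]
  have hs : ∀ i, (1 : ℝ) = mink (T.normal i) (T.normal i) := fun i => (T.mink_normal_self i).symm
  fin_cases i <;> fin_cases j
  exacts [hs 0, h 5, h 4, h 3, h' 5, hs 1, h 2, h 1, h' 4, h' 2, hs 2, h 0, h' 3, h' 1, h' 0, hs 3]

theorem det_normal_ne_zero : (Matrix.of T.normal).det ≠ 0 :=
  det_of_ne_zero_iff.2 (linearIndependent_of_mink (u := T.v)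
    (fun i => neg_ne_zero.2 (inv_ne_zero (T.scale_pos i).ne')) T.mink_normal_v)

theorem det_gramOf_neg : (gramOf T.angles).det < 0 := by
  have : gramOf T.angles = Matrix.of fun i j => mink (T.normal i) (T.normal j) := by
    ext i j; exact T.gramOf_angles i j
  rw [this, det_mink]
  exact neg_neg_of_pos (sq_pos_of_ne_zero T.det_normal_ne_zero)

/-- The vectors −`scale k` • `v k` are dual to the normals. Pairing this expansion with `v j` shows
that the Gram matrices of the two bases are inverse to each other. -/
theorem normal_expansion (i : Fin 4) :
    T.normal i = ∑ k, (-(mink (T.normal i) (T.normal k) * T.scale k)) • T.v k := by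
  apply eq_of_mink_eq T.det_normal_ne_zero
  intro j
  have : ∀ k, mink (T.v k) (T.normal j) = if k = j then -(T.scale j)⁻¹ else 0 := fun k => by
    rw [mink_comm, mink_normal_v]
    simp [eq_comm]
  simp only [mink_sum_left, mink_smul_left, this, mul_ite, mul_zero, Finset.sum_ite_eq',
    Finset.mem_univ, if_true]
  have := (T.scale_pos j).ne'
  field_simp

theorem gramOf_mul_eq_one : gramOf T.angles *
    Matrix.of (fun i j => T.scale i * T.scale j * mink (T.v i) (T.v j)) = 1 := by
  ext i j
  have h := congrArg (fun x => mink x (T.v j)) (T.normal_expansion i)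
  simp only [mink_normal_v, mink_sum_left, mink_smul_left] at h
  rw [Matrix.mul_apply, Matrix.one_apply]
  simp only [Matrix.of_apply, gramOf_angles]
  have h2 : ∑ k, mink (T.normal i) (T.normal k) * (T.scale k * T.scale j * mink (T.v k) (T.v j)) =
      -T.scale j * ∑ k, -(mink (T.normal i) (T.normal k) * T.scale k) * mink (T.v k) (T.v j) := by
    rw [Finset.mul_sum]
    exact Finset.sum_congr rfl fun k _ => by ring
  rw [h2, ← h]
  split_ifs with hij
  · subst hij
    have := (T.scale_pos i).ne'
    field_simp
  · simp

theorem inv_gramOf (i j : Fin 4) :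
    (gramOf T.angles)⁻¹ i j = T.scale i * T.scale j * mink (T.v i) (T.v j) := by
  rw [Matrix.inv_eq_right_inv T.gramOf_mul_eq_one]
  rfl

theorem inv_gramOf_self (i : Fin 4) :
    (gramOf T.angles)⁻¹ i i = -(T.scale i ^ 2 * T.eps i) := by
  rw [inv_gramOf, mink_v_self]
  ring

theorem adjugate_gramOf_angles (i j : Fin 4) : (gramOf T.angles).adjugate i j =
    (gramOf T.angles).det * (T.scale i * T.scale j * mink (T.v i) (T.v j)) := by
  rw [← inv_gramOf, Matrix.inv_def, Matrix.smul_apply, Ring.inverse_eq_inv', smul_eq_mul,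
    mul_inv_cancel_left₀ T.det_gramOf_neg.ne]

/-- Cramer's rule for the diagonal of the inverse. Since −det G > 0, the sign of the minor is the
type of the vertex. -/
theorem det_gramMinor (i : Fin 4) :
    (T.gramMinor i).det = -(gramOf T.angles).det * (T.scale i ^ 2 * T.eps i) := by
  have h := Matrix.adjugate_fin_succ_eq_det_submatrix (gramOf T.angles) i i
  rw [← two_mul, pow_mul] at h
  rw [adjugate_gramOf_angles, mink_v_self] at h
  simp only [even_two, Even.neg_pow, one_pow, one_mul] at h
  rw [gramMinor, gram_eq_gramOf, ← h]
  ring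

theorem eta_eq (h : T.NoIdeal) :
    T.eta = Real.sqrt (-(gramOf T.angles).det) * ∏ i, T.scale i := by
  have hd := T.det_gramOf_neg
  have h1 : ∀ i, T.eps i * (T.gramMinor i).det = -(gramOf T.angles).det * T.scale i ^ 2 :=
    fun i => by
      rw [det_gramMinor]
      linear_combination -(gramOf T.angles).det * T.scale i ^ 2 * T.eps_sq (h i)
  rw [eta, gram_eq_gramOf]
  simp only [h1]
  rw [Finset.prod_mul_distrib, Finset.prod_const, Finset.prod_pow]
  have : (-(gramOf T.angles).det) ^ (Finset.univ : Finset (Fin 4)).card * (∏ i, T.scale i) ^ 2 /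
      (-(gramOf T.angles).det) ^ 3 = -(gramOf T.angles).det * (∏ i, T.scale i) ^ 2 := by
    rw [Finset.card_univ, Fintype.card_fin]
    have : -(gramOf T.angles).det ≠ 0 := by linarith
    field_simp
  rw [this, Real.sqrt_mul (by linarith),
    Real.sqrt_sq (Finset.prod_nonneg fun i _ => (T.scale_pos i).le)]

/-! ### Lengths -/

/-- The number `σ`, in terms of the products of the vertices. -/
def root (i j : Fin 4) : ℝ := Real.sqrt (mink (T.v i) (T.v j) ^ 2 - T.eps i * T.eps j)

theorem root_pos {i j : Fin 4} (hij : i ≠ j) : 0 < T.root i j :=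
  Real.sqrt_pos.2 (sub_pos.2 (T.eps_mul_lt_sq hij))

theorem root_sq {i j : Fin 4} (hij : i ≠ j) :
    T.root i j ^ 2 = mink (T.v i) (T.v j) ^ 2 - T.eps i * T.eps j :=
  Real.sq_sqrt (sub_pos.2 (T.eps_mul_lt_sq hij)).le

theorem root_comm (i j : Fin 4) : T.root i j = T.root j i := by
  rw [root, root, mink_comm, mul_comm (T.eps i)]

/-- In Jacobi's identity the adjugate is det G times the scaled vertex products, so a factor det G
cancels; both sides are positive, hence the squares determine them. This is the source of the
right-hand factor D. -/
theorem sin_angles (e : Fin 6) : Real.sin (T.angles e) =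
    T.root (edgeFst e) (edgeSnd e) * (T.scale (edgeFst e) * T.scale (edgeSnd e)) *
      Real.sqrt (-(gramOf T.angles).det) := by
  have hne : edgeFst e ≠ edgeSnd e := by revert e; decide
  have hd := T.det_gramOf_neg
  have h1 := T.root_pos hne
  have h2 := T.scale_pos (edgeFst e)
  have h3 := T.scale_pos (edgeSnd e)
  have hs := Real.sin_pos_of_mem_Ioo (T.angles_mem_Ioo e)
  refine (pow_left_inj₀ hs.le (by positivity) two_ne_zero).1 ?_
  have h := adjugate_gramOf T.angles e
  simp only [adjugate_gramOf_angles, mink_v_self] at h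
  rw [mul_pow, mul_pow, root_sq T hne, Real.sq_sqrt (by linarith)]
  refine mul_left_cancel₀ hd.ne ?_
  linarith

theorem edgeEnd_of_kind_neg_one {i : Fin 4} (j : Fin 4) (hi : T.kind i = -1) :
    T.edgeEnd i j =
      (T.root i j)⁻¹ • (T.v j + (-mink (T.v i) (T.v j)) • T.v i) := by
  have h1 : T.kind i ≠ 1 := by rw [hi]; decide
  rw [edgeEnd, if_neg h1, neg_smul, ← sub_eq_add_neg]
  dsimp only
  congr 3
  rw [sub_eq_add_neg, ← neg_smul]
  simp only [mink_add_left, mink_add_right, mink_smul_left, mink_smul_right, mink_v_self,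
    mink_comm (T.v j) (T.v i), T.eps_of_kind_neg_one hi]
  ring

theorem hypDist_comm (x y : Mink) : hypDist x y = hypDist y x := by
  rw [hypDist, hypDist, mink_comm]

/-- The length of an edge, in terms of the product of its end points. -/
theorem len_eq {i j : Fin 4} (hij : i ≠ j) (hi : T.kind i ≠ 0) (hj : T.kind j ≠ 0) :
    T.len i j = Real.log (-mink (T.v i) (T.v j) + T.root i j) := by
  have hm := T.mink_neg i j hij
  have hr := T.root_pos hij
  have hr2 := T.root_sq hij
  -- For ends of different type, minus the product of the end points is σ, and σ² − 1 = ⟨v_i, v_j⟩².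
  -- Thus the two summands in arcosh x = log (x + √(x² − 1)) merely change places.
  have mixed : ∀ i j : Fin 4, i ≠ j → T.kind i = -1 → T.kind j = 1 →
      T.len i j = Real.log (-mink (T.v i) (T.v j) + T.root i j) := fun i j hij hi hj => by
    have hm := T.mink_neg i j hij
    have hr := T.root_pos hij
    have hr2 := T.root_sq hij
    have he : T.edgeEnd j i = T.v j := if_pos hj
    have hc : -mink (T.edgeEnd i j) (T.edgeEnd j i) = T.root i j := by
      rw [he, T.edgeEnd_of_kind_neg_one j hi]
      simp only [mink_add_left, mink_smul_left, mink_v_self, T.eps_of_kind_one hj]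
      rw [T.eps_of_kind_one hj, T.eps_of_kind_neg_one hi] at hr2
      field_simp
      linarith
    rw [len, hypDist, hc, Real.arcosh, hr2, T.eps_of_kind_one hj, T.eps_of_kind_neg_one hi,
      add_comm]
    congr 2
    rw [show mink (T.v i) (T.v j) ^ 2 - -1 * 1 - 1 = (-mink (T.v i) (T.v j)) ^ 2 by ring,
      Real.sqrt_sq (by linarith)]
  rcases T.kind_cases i with hi' | hi' | hi'
  · rcases T.kind_cases j with hj' | hj' | hj'
    · have he : T.edgeEnd i j = T.v i := if_pos hi'
      have he' : T.edgeEnd j i = T.v j := if_pos hj'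
      rw [len, hypDist, he, he', Real.arcosh, root, T.eps_of_kind_one hi', T.eps_of_kind_one hj',
        neg_sq, mul_one]
    · exact absurd hj' hj
    · rw [len, hypDist_comm, mink_comm, root_comm]
      exact mixed j i hij.symm hj' hi'
  · exact absurd hi' hi
  · rcases T.kind_cases j with hj' | hj' | hj'
    · exact mixed i j hij hi' hj'
    · exact absurd hj' hj
    · have hc : -mink (T.edgeEnd i j) (T.edgeEnd j i) = -mink (T.v i) (T.v j) := by
        rw [T.edgeEnd_of_kind_neg_one j hi', T.edgeEnd_of_kind_neg_one i hj', root_comm T j i]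
        rw [T.eps_of_kind_neg_one hi', T.eps_of_kind_neg_one hj'] at hr2
        simp only [mink_add_left, mink_add_right, mink_smul_left, mink_smul_right, mink_v_self,
          mink_comm (T.v j) (T.v i), T.eps_of_kind_neg_one hi', T.eps_of_kind_neg_one hj']
        field_simp
        rw [hr2]
        ring
      rw [len, hypDist, hc, Real.arcosh, root, T.eps_of_kind_neg_one hi',
        T.eps_of_kind_neg_one hj', neg_sq, neg_mul_neg, mul_one]

theorem exp_len {i j : Fin 4} (hij : i ≠ j) (hi : T.kind i ≠ 0) (hj : T.kind j ≠ 0) :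
    Real.exp (T.len i j) = -mink (T.v i) (T.v j) + T.root i j := by
  have := T.mink_neg i j hij
  have := T.root_pos hij
  rw [T.len_eq hij hi hj, Real.exp_log (by linarith)]

/-- The two roots −⟨v_i, v_j⟩ ± σ have product ε_i ε_j. -/
theorem exp_neg_len {i j : Fin 4} (hij : i ≠ j) (hi : T.kind i ≠ 0) (hj : T.kind j ≠ 0) :
    T.eps i * T.eps j * Real.exp (-T.len i j) = -mink (T.v i) (T.v j) - T.root i j := by
  have := T.mink_neg i j hij
  have := T.root_pos hij
  have h := T.root_sq hij
  rw [Real.exp_neg, T.exp_len hij hi hj, ← div_eq_mul_inv, div_eq_iff (by linarith)]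
  linarith

theorem sig_eq {i j : Fin 4} (hij : i ≠ j) (hi : T.kind i ≠ 0) (hj : T.kind j ≠ 0) :
    T.sig i j = T.root i j := by
  have h := T.exp_neg_len hij hi hj
  rw [sig, T.exp_len hij hi hj]
  linarith

theorem sig'_eq {i j : Fin 4} (hij : i ≠ j) (hi : T.kind i ≠ 0) (hj : T.kind j ≠ 0) :
    T.sig' i j = -mink (T.v i) (T.v j) := by
  have h := T.exp_neg_len hij hi hj
  rw [sig', T.exp_len hij hi hj]
  linarith

end GenTetrahedron

/-! ### Smoothness of the inverse Gram matrix -/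

section Smooth

variable {E : Type*} [NormedAddCommGroup E] [NormedSpace ℝ E] {n : ℕ} {k : WithTop ℕ∞}

theorem contDiffAt_det {A : E → Matrix (Fin n) (Fin n) ℝ} {x : E}
    (h : ∀ i j, ContDiffAt ℝ k (fun y => A y i j) x) :
    ContDiffAt ℝ k (fun y => (A y).det) x := by
  simp only [Matrix.det_apply, Units.smul_def, zsmul_eq_mul]
  exact ContDiffAt.sum fun σ _ => contDiffAt_const.mul (contDiffAt_prod fun i _ => h _ _)

theorem contDiffAt_inv_apply {A : E → Matrix (Fin n) (Fin n) ℝ} {x : E}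
    (h : ∀ i j, ContDiffAt ℝ k (fun y => A y i j) x) (hd : (A x).det ≠ 0) (i j : Fin n) :
    ContDiffAt ℝ k (fun y => (A y)⁻¹ i j) x := by
  simp only [Matrix.inv_def, Matrix.smul_apply, Ring.inverse_eq_inv', smul_eq_mul,
    Matrix.adjugate_apply]
  refine ((contDiffAt_det h).inv hd).mul (contDiffAt_det fun l m => ?_)
  by_cases hl : l = j
  · subst hl
    simpa using contDiffAt_const
  · simpa [Matrix.updateRow_ne hl] using h l m

end Smooth

theorem contDiff_gramOf (i j : Fin 4) : ContDiff ℝ 1 (fun a => gramOf a i j) := by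
  have h : ∀ e : Fin 6, ContDiff ℝ 1 (fun a : Fin 6 → ℝ => -Real.cos (a e)) := fun e =>
    (Real.contDiff_cos.comp (contDiff_apply ℝ ℝ e)).neg
  have h1 : ContDiff ℝ 1 (fun _ : Fin 6 → ℝ => (1 : ℝ)) := contDiff_const
  fin_cases i <;> fin_cases j
  exacts [h1, h 5, h 4, h 3, h 5, h1, h 2, h 1, h 4, h 2, h1, h 0, h 3, h 1, h 0, h1]

theorem contDiffAt_inv_gramOf {a : Fin 6 → ℝ} (hd : (gramOf a).det ≠ 0) (i j : Fin 4) :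
    ContDiffAt ℝ 1 (fun a => (gramOf a)⁻¹ i j) a :=
  contDiffAt_inv_apply (fun i j => (contDiff_gramOf i j).contDiffAt) hd i j

/-! ### Derivatives of the inverse Gram matrix along the coordinate lines -/

theorem hasDerivAt_line (a : Fin 6 → ℝ) (f : Fin 6) :
    HasDerivAt (fun t : ℝ => a + t • (Pi.single f 1 : Fin 6 → ℝ)) (Pi.single f 1) 0 := by
  simpa using ((hasDerivAt_id (0 : ℝ)).smul_const (Pi.single f 1 : Fin 6 → ℝ)).const_add a

/-- The derivative of the Gram matrix with respect to an angle. -/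
def gramDeriv (a : Fin 6 → ℝ) (f : Fin 6) : Matrix (Fin 4) (Fin 4) ℝ :=
  Real.sin (a f) • (Matrix.single (edgeFst f.rev) (edgeSnd f.rev) 1 +
    Matrix.single (edgeSnd f.rev) (edgeFst f.rev) 1)

theorem hasDerivAt_gramOf (a : Fin 6 → ℝ) (f : Fin 6) (i j : Fin 4) :
    HasDerivAt (fun t : ℝ => gramOf (a + t • (Pi.single f 1 : Fin 6 → ℝ)) i j)
      (gramDeriv a f i j) 0 := by
  set d : Fin 6 → ℝ := fun e => Real.sin (a e) * (Pi.single f 1 : Fin 6 → ℝ) e with hd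
  have h : ∀ e : Fin 6, HasDerivAt
      (fun t : ℝ => -Real.cos ((a + t • (Pi.single f 1 : Fin 6 → ℝ)) e)) (d e) 0 := fun e => by
    have := (hasDerivAt_pi.1 (hasDerivAt_line a f) e).cos.fun_neg
    simpa [hd] using this
  have h1 : HasDerivAt (fun _ : ℝ => (1 : ℝ)) 0 0 := hasDerivAt_const _ _
  have e1 : gramDeriv a f = !![0, d 5, d 4, d 3; d 5, 0, d 2, d 1; d 4, d 2, 0, d 0;
      d 3, d 1, d 0, 0] := by
    ext i j
    fin_cases f <;> fin_cases i <;> fin_cases j <;>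
      simp [gramDeriv, hd, edgeFst, edgeSnd, Matrix.single, Fin.rev, Pi.single, Function.update]
  rw [e1]
  fin_cases i <;> fin_cases j
  exacts [h1, h 5, h 4, h 3, h 5, h1, h 2, h 1, h 4, h 2, h1, h 0, h 3, h 1, h 0, h1]

theorem hasDerivAt_inv_gramOf {a : Fin 6 → ℝ} (hd : (gramOf a).det ≠ 0) (f : Fin 6)
    (i j : Fin 4) :
    HasDerivAt (fun t : ℝ => (gramOf (a + t • (Pi.single f 1 : Fin 6 → ℝ)))⁻¹ i j)
      (-((gramOf a)⁻¹ * gramDeriv a f * (gramOf a)⁻¹) i j) 0 := by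
  have h0 : a + (0 : ℝ) • (Pi.single f 1 : Fin 6 → ℝ) = a := by simp
  have hex : ∀ i j, ∃ d, HasDerivAt
      (fun t : ℝ => (gramOf (a + t • (Pi.single f 1 : Fin 6 → ℝ)))⁻¹ i j) d 0 := fun i j =>
    ⟨_, HasFDerivAt.comp_hasDerivAt (l := fun a => (gramOf a)⁻¹ i j) 0
      (by rw [h0]; exact ((contDiffAt_inv_gramOf hd i j).differentiableAt one_ne_zero).hasFDerivAt)
      (hasDerivAt_line a f)⟩
  choose d hd' using hex
  have hdet : ∀ᶠ t : ℝ in 𝓝 0, (gramOf (a + t • (Pi.single f 1 : Fin 6 → ℝ))).det ≠ 0 := by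
    have hc : ContinuousAt (fun t : ℝ => (gramOf (a + t • (Pi.single f 1 : Fin 6 → ℝ))).det) 0 :=
      ContinuousAt.comp (g := fun a => (gramOf a).det)
        (contDiffAt_det (k := 1) fun i j => (contDiff_gramOf i j).contDiffAt).continuousAt
        (hasDerivAt_line a f).continuousAt
    exact hc.eventually_ne (by rwa [h0])
  -- Product rule for G G⁻¹ = 1. This identity holds only for t near 0, because a singular matrix
  -- has inverse 0 by convention.
  have hmat : gramDeriv a f * (gramOf a)⁻¹ + gramOf a * Matrix.of d = 0 := by
    ext i j
    have h1 := HasDerivAt.fun_sum (u := Finset.univ)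
      fun k _ => (hasDerivAt_gramOf a f i k).mul (hd' k j)
    have h2 : HasDerivAt (fun _ : ℝ => (1 : Matrix (Fin 4) (Fin 4) ℝ) i j) 0 0 :=
      hasDerivAt_const _ _
    have h3 := h1.unique (h2.congr_of_eventuallyEq (by
      filter_upwards [hdet] with t ht
      rw [← Matrix.mul_nonsing_inv _ (isUnit_iff_ne_zero.2 ht), Matrix.mul_apply]
      rfl))
    simpa [Matrix.mul_apply, Finset.sum_add_distrib, h0] using h3
  have hres : Matrix.of d = -((gramOf a)⁻¹ * gramDeriv a f * (gramOf a)⁻¹) := by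
    have := congrArg (fun X => (gramOf a)⁻¹ * X) hmat
    simp only [mul_add, mul_zero, ← mul_assoc,
      Matrix.nonsing_inv_mul _ (isUnit_iff_ne_zero.2 hd), one_mul] at this
    exact eq_neg_of_add_eq_zero_right this
  have := hd' i j
  rwa [show d i j = Matrix.of d i j from rfl, hres] at this

theorem mul_gramDeriv_mul (a : Fin 6 → ℝ) (f : Fin 6) (H : Matrix (Fin 4) (Fin 4) ℝ)
    (i j : Fin 4) : (H * gramDeriv a f * H) i j = Real.sin (a f) *
      (H i (edgeFst f.rev) * H (edgeSnd f.rev) j + H i (edgeSnd f.rev) * H (edgeFst f.rev) j) := by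
  rw [gramDeriv, Matrix.mul_smul, Matrix.smul_mul, mul_add, add_mul]
  simp [Matrix.mul_apply, Matrix.single, ite_and]

/-! ### Lengths as functions of the angles -/

/-- The length of an edge with non-ideal end points, as a function of the dihedral angles. -/
def lenOf (a : Fin 6 → ℝ) (e : Fin 6) : ℝ :=
  Real.log (-(gramOf a)⁻¹ (edgeFst e) (edgeSnd e) +
      Real.sqrt ((gramOf a)⁻¹ (edgeFst e) (edgeSnd e) ^ 2 -
        (gramOf a)⁻¹ (edgeFst e) (edgeFst e) * (gramOf a)⁻¹ (edgeSnd e) (edgeSnd e))) -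
    1 / 2 * Real.log ((gramOf a)⁻¹ (edgeFst e) (edgeFst e) * (gramOf a)⁻¹ (edgeSnd e) (edgeSnd e))

/-- The function is arcosh(−h/√(pq)) if pq > 0 and arsinh(−h/√|pq|) if pq < 0; the logarithmic form
treats equal and different types of ends alike. -/
theorem hasDerivAt_log_sqrt {h p q : ℝ → ℝ} {h' p' q' t : ℝ} (hh : HasDerivAt h h' t)
    (hp : HasDerivAt p p' t) (hq : HasDerivAt q q' t) (h0 : h t < 0) (p0 : p t ≠ 0)
    (q0 : q t ≠ 0) (hR : 0 < h t ^ 2 - p t * q t) :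
    HasDerivAt (fun t => Real.log (-h t + Real.sqrt (h t ^ 2 - p t * q t))
        - 1 / 2 * Real.log (p t * q t))
      ((-h' + 1 / 2 * h t * (p' / p t + q' / q t)) / Real.sqrt (h t ^ 2 - p t * q t)) t := by
  have hpq := hp.fun_mul hq
  have hsq := ((hh.fun_pow 2).fun_sub hpq).sqrt hR.ne'
  have hs := Real.sqrt_pos.2 hR
  have hs2 := Real.sq_sqrt hR.le
  have hpos : 0 < -h t + Real.sqrt (h t ^ 2 - p t * q t) := by linarith
  have := ((hh.fun_neg.fun_add hsq).log hpos.ne').fun_sub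
    ((hpq.log (mul_ne_zero p0 q0)).const_mul (1 / 2))
  refine this.congr_deriv ?_
  generalize Real.sqrt (h t ^ 2 - p t * q t) = R at *
  obtain ⟨S, hS⟩ : ∃ S, S = -h t + R := ⟨_, rfl⟩
  rw [← hS] at hpos ⊢
  have := hs.ne'
  have := hpos.ne'
  obtain rfl : R = S + h t := by linarith
  field_simp
  linear_combination -(p' * q t + p t * q') * hs2

theorem edgeFst_ne_edgeSnd (e : Fin 6) : edgeFst e ≠ edgeSnd e := by
  revert e; decide

namespace GenTetrahedron

variable (T : GenTetrahedron)

theorem sqrt_inv_gramOf {i j : Fin 4} : Real.sqrt ((gramOf T.angles)⁻¹ i j ^ 2 -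
    (gramOf T.angles)⁻¹ i i * (gramOf T.angles)⁻¹ j j) =
      T.scale i * T.scale j * T.root i j := by
  have hi := T.scale_pos i
  have hj := T.scale_pos j
  rw [inv_gramOf_self, inv_gramOf_self, inv_gramOf, root,
    show (T.scale i * T.scale j * mink (T.v i) (T.v j)) ^ 2 -
        -(T.scale i ^ 2 * T.eps i) * -(T.scale j ^ 2 * T.eps j) =
      (T.scale i * T.scale j) ^ 2 * (mink (T.v i) (T.v j) ^ 2 - T.eps i * T.eps j) by ring,
    Real.sqrt_mul (sq_nonneg _), Real.sqrt_sq (by positivity)]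

theorem lengths_eq_lenOf {e : Fin 6} (h : T.EdgeNoIdeal e) : T.lengths e = lenOf T.angles e := by
  have hij := edgeFst_ne_edgeSnd e
  have hm := T.mink_neg _ _ hij
  have hr := T.root_pos hij
  have hi := T.scale_pos (edgeFst e)
  have hj := T.scale_pos (edgeSnd e)
  have hi2 := T.eps_sq h.1
  have hj2 := T.eps_sq h.2
  rw [lengths, T.len_eq hij h.1 h.2, lenOf, sqrt_inv_gramOf, inv_gramOf, inv_gramOf_self,
    inv_gramOf_self]
  generalize edgeFst e = i at *
  generalize edgeSnd e = j at *
  -- `Real.log` only sees the absolute value, so the sign ε_i ε_j drops out.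
  have h1 : Real.log (-(T.scale i ^ 2 * T.eps i) * -(T.scale j ^ 2 * T.eps j)) =
      2 * Real.log (T.scale i * T.scale j) := by
    rw [show -(T.scale i ^ 2 * T.eps i) * -(T.scale j ^ 2 * T.eps j) =
      (T.eps i * T.eps j) * (T.scale i * T.scale j) ^ 2 by ring]
    rcases mul_self_eq_one_iff.1 ((sq _).symm.trans hi2) with h1 | h1 <;>
      rcases mul_self_eq_one_iff.1 ((sq _).symm.trans hj2) with h2 | h2 <;>
      simp [h1, h2, Real.log_neg_eq_log, Real.log_pow]
  rw [h1, show -(T.scale i * T.scale j * mink (T.v i) (T.v j)) + T.scale i * T.scale j * T.root i j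
    = T.scale i * T.scale j * (-mink (T.v i) (T.v j) + T.root i j) by ring,
    Real.log_mul (by positivity) (by linarith)]
  ring

theorem inv_gramOf_self_ne_zero {i : Fin 4} (h : T.kind i ≠ 0) : (gramOf T.angles)⁻¹ i i ≠ 0 := by
  rw [inv_gramOf_self]
  exact neg_ne_zero.2 (mul_ne_zero (pow_ne_zero _ (T.scale_pos i).ne') (T.eps_ne_zero h))

theorem inv_gramOf_sq_sub_pos {i j : Fin 4} (hij : i ≠ j) : 0 < (gramOf T.angles)⁻¹ i j ^ 2 -
    (gramOf T.angles)⁻¹ i i * (gramOf T.angles)⁻¹ j j := by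
  apply Real.sqrt_pos.1
  rw [sqrt_inv_gramOf]
  exact mul_pos (mul_pos (T.scale_pos i) (T.scale_pos j)) (T.root_pos hij)

theorem inv_gramOf_neg {i j : Fin 4} (hij : i ≠ j) : (gramOf T.angles)⁻¹ i j < 0 := by
  rw [inv_gramOf]
  exact mul_neg_of_pos_of_neg (mul_pos (T.scale_pos i) (T.scale_pos j)) (T.mink_neg i j hij)

theorem contDiffAt_lenOf {e : Fin 6} (h : T.EdgeNoIdeal e) :
    ContDiffAt ℝ 1 (fun a => lenOf a e) T.angles := by
  have hH := contDiffAt_inv_gramOf T.det_gramOf_neg.ne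
  have hij := edgeFst_ne_edgeSnd e
  have hpos := T.inv_gramOf_sq_sub_pos hij
  have := T.inv_gramOf_neg hij
  have hs := Real.sqrt_pos.2 hpos
  exact (((hH _ _).neg.add ((((hH _ _).pow 2).sub ((hH _ _).mul (hH _ _))).sqrt hpos.ne')).log
    (by linarith)).sub (contDiffAt_const.mul (((hH _ _).mul (hH _ _)).log
      (mul_ne_zero (T.inv_gramOf_self_ne_zero h.1) (T.inv_gramOf_self_ne_zero h.2))))

/-! ### The partial derivatives and the matrix −η D S D -/

/-- The factor of the partial derivative of the product of the vertices `i`, `j` with respect to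
the angle between the faces opposite to `p`, `q`. -/
def bracket (i j p q : Fin 4) : ℝ :=
  mink (T.v i) (T.v p) * mink (T.v j) (T.v q) + mink (T.v i) (T.v q) * mink (T.v j) (T.v p) +
    mink (T.v i) (T.v j) * (T.eps i * mink (T.v i) (T.v p) * mink (T.v i) (T.v q) +
      T.eps j * mink (T.v j) (T.v p) * mink (T.v j) (T.v q))

/-- An edge and its opposite together contain every vertex exactly once. -/
theorem scale_mul_scale (f : Fin 6) : T.scale (edgeFst f) * T.scale (edgeSnd f) *
    (T.scale (edgeFst f.rev) * T.scale (edgeSnd f.rev)) = ∏ i, T.scale i := by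
  rw [Fin.prod_univ_four]
  fin_cases f <;> simp [edgeFst, edgeSnd, Fin.rev] <;> ring

/-- The scales at the ends of e cancel. Those at the ends of f come from sin a_f, those at the ends
of `f.rev` from H dG H; together with √(−det G) they form η. -/
theorem fderiv_lenOf (h : T.NoIdeal) (e f : Fin 6) :
    fderiv ℝ (fun a => lenOf a e) T.angles (Pi.single f 1) =
      T.eta * T.root (edgeFst f) (edgeSnd f) *
        T.bracket (edgeFst e) (edgeSnd e) (edgeFst f.rev) (edgeSnd f.rev) /
          T.root (edgeFst e) (edgeSnd e) := by
  have h0 : T.angles + (0 : ℝ) • (Pi.single f 1 : Fin 6 → ℝ) = T.angles := by simp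
  have hd := T.det_gramOf_neg.ne
  have hij := edgeFst_ne_edgeSnd e
  have h1 := HasFDerivAt.comp_hasDerivAt (l := fun a => lenOf a e) 0
      (by rw [h0]; exact ((T.contDiffAt_lenOf ⟨h _, h _⟩).differentiableAt one_ne_zero).hasFDerivAt)
      (hasDerivAt_line T.angles f)
  have h2 := hasDerivAt_log_sqrt
    (hasDerivAt_inv_gramOf hd f (edgeFst e) (edgeSnd e))
    (hasDerivAt_inv_gramOf hd f (edgeFst e) (edgeFst e))
    (hasDerivAt_inv_gramOf hd f (edgeSnd e) (edgeSnd e))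
    (by rw [h0]; exact T.inv_gramOf_neg hij)
    (by rw [h0]; exact T.inv_gramOf_self_ne_zero (h _))
    (by rw [h0]; exact T.inv_gramOf_self_ne_zero (h _))
    (by rw [h0]; exact T.inv_gramOf_sq_sub_pos hij)
  refine (h1.unique h2).trans ?_
  have hr := T.root_pos hij
  have hi2 := T.eps_sq (h (edgeFst e))
  have hj2 := T.eps_sq (h (edgeSnd e))
  have hi0 := T.eps_ne_zero (h (edgeFst e))
  have hj0 := T.eps_ne_zero (h (edgeSnd e))
  rw [h0, sqrt_inv_gramOf, T.eta_eq h, ← T.scale_mul_scale f]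
  simp only [mul_gramDeriv_mul, inv_gramOf_self, T.sin_angles f]
  simp only [inv_gramOf, bracket]
  generalize edgeFst e = i at *
  generalize edgeSnd e = j at *
  generalize edgeFst f.rev = p at *
  generalize edgeSnd f.rev = q at *
  rw [mink_comm (T.v p) (T.v i), mink_comm (T.v q) (T.v i), mink_comm (T.v p) (T.v j),
    mink_comm (T.v q) (T.v j)]
  have hsi := (T.scale_pos i).ne'
  have hsj := (T.scale_pos j).ne'
  have hdiv : ∀ (k : Fin 4) (X : ℝ), T.eps k ^ 2 = 1 → X / -(T.scale k ^ 2 * T.eps k) =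
      -(X * T.eps k) / T.scale k ^ 2 := fun k X hk => by
    have hsk := (T.scale_pos k).ne'
    have : T.eps k ≠ 0 := fun h0 => by simp [h0] at hk
    field_simp
    rw [hk, mul_one]
  rw [hdiv i _ hi2, hdiv j _ hj2]
  field_simp
  ring


/-- With ε² = 1 and ⟨v_i, v_i⟩ = −ε_i, the bracket is −σ_e² for opposite edges, and −σ_e² ε_j σ'_jk
if e = ij and f share just the vertex j and k lies on neither. Only for f = e does σ_e² fail to
factor out formally, whence the denominator of ω. -/
theorem bracket_eq_matS (h : T.NoIdeal) (e f : Fin 6) :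
    T.bracket (edgeFst e) (edgeSnd e) (edgeFst f.rev) (edgeSnd f.rev) =
      -(T.root (edgeFst e) (edgeSnd e) ^ 2 * T.matS e f) := by
  have hs : ∀ i j, i ≠ j → T.sig' i j = -mink (T.v i) (T.v j) := fun i j hij =>
    T.sig'_eq hij (h i) (h j)
  have hω : ∀ k l i j, k ≠ l → T.root k l ^ 2 * T.omega k l i j =
      -(T.sig' i k * T.sig' j l) + T.eps l * T.sig' i l * T.sig' j l * T.sig' k l
        - T.sig' i l * T.sig' j k + T.eps k * T.sig' i k * T.sig' j k * T.sig' k l :=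
    fun k l i j hkl => by
      rw [omega, T.sig_eq hkl (h k) (h l), mul_div_cancel₀ _ (pow_ne_zero 2 (T.root_pos hkl).ne')]
  have h0 := T.eps_sq (h 0)
  have h1 := T.eps_sq (h 1)
  have h2 := T.eps_sq (h 2)
  have h3 := T.eps_sq (h 3)
  have hsymm : ∀ i j, mink (T.v i) (T.v j) = mink (T.v j) (T.v i) := fun i j => mink_comm _ _
  have c10 := hsymm 1 0
  have c20 := hsymm 2 0
  have c30 := hsymm 3 0
  have c21 := hsymm 2 1
  have c31 := hsymm 3 1
  have c32 := hsymm 3 2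
  have r := T.root_sq (edgeFst_ne_edgeSnd e)
  simp only [bracket]
  fin_cases e <;> fin_cases f
  all_goals
    simp [edgeFst, edgeSnd, Fin.rev, matS] at r ⊢
  all_goals
    try rw [hω _ _ _ _ (by decide)]
    try simp (disch := decide) only [hs, c10, c20, c30, c21, c31, c32, mink_v_self]
    try rw [r]
  all_goals grind

theorem jacMatrix_apply (h : T.NoIdeal) (e f : Fin 6) :
    T.jacMatrix e f = fderiv ℝ (fun a => lenOf a e) T.angles (Pi.single f 1) := by
  have hr := (T.root_pos (edgeFst_ne_edgeSnd e)).ne'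
  rw [fderiv_lenOf T h, bracket_eq_matS T h, jacMatrix, matD]
  simp only [Matrix.neg_apply, Matrix.smul_apply, Matrix.mul_diagonal, Matrix.diagonal_mul,
    smul_eq_mul]
  rw [T.sig_eq (edgeFst_ne_edgeSnd e) (h _) (h _), T.sig_eq (edgeFst_ne_edgeSnd f) (h _) (h _)]
  field_simp

theorem hasFDerivAt_lenOf (h : T.NoIdeal) :
    HasFDerivAt lenOf (Matrix.toLin' T.jacMatrix).toContinuousLinearMap T.angles := by
  refine hasFDerivAt_pi'.2 fun e => ?_
  have h1 := ((T.contDiffAt_lenOf (e := e) ⟨h _, h _⟩).differentiableAt one_ne_zero).hasFDerivAt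
  refine h1.congr_fderiv ?_
  ext v
  have hsingle : ∀ f : Fin 6, (fun j => if f = j then 1 else 0) = (Pi.single f 1 : Fin 6 → ℝ) :=
    fun f => by
      ext j
      simp [Pi.single_apply, eq_comm]
  rw [← ContinuousLinearMap.coe_coe (fderiv ℝ _ _), LinearMap.pi_apply_eq_sum_univ]
  simp [Matrix.mulVec, dotProduct, T.jacMatrix_apply h, mul_comm, hsingle]

end GenTetrahedron

/-! ### Existence -/

/-- Vectors with Gram matrix close to that of a given basis can be found close to the basis. -/
theorem eventually_exists_gram {N : Fin 4 → Mink} (hN : (Matrix.of N).det ≠ 0)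
    {P : (Fin 4 → Mink) → Prop} (hP : ∀ᶠ N' in 𝓝 N, P N') :
    ∀ᶠ G : Fin 4 → Fin 4 → ℝ in 𝓝 fun i j => mink (N i) (N j),
      (∀ i j, G i j = G j i) → ∃ N', P N' ∧ ∀ i j, mink (N' i) (N' j) = G i j := by
  -- The derivative of the Gram map reaches only symmetric matrices. The added antisymmetric term
  -- makes it V ↦ 2⟨V_i, N_j⟩, which is onto all matrices by duality; at a symmetric value of F that
  -- term vanishes.
  set F : (Fin 4 → Mink) → Fin 4 → Fin 4 → ℝ := fun N' i j =>
    mink (N' i) (N' j) + mink (N' i) (N j) - mink (N i) (N' j) with hF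
  have hmk : ∀ i j, ContDiff ℝ 1 fun N' : Fin 4 → Mink => F N' i j := fun i j => by
    simp only [hF, mink]
    fun_prop
  have hFc : ContDiff ℝ 1 F := contDiff_pi.2 fun i => contDiff_pi.2 fun j => hmk i j
  have hs := hFc.contDiffAt.hasStrictFDerivAt (x := N) one_ne_zero
  have hval : ∀ V i j, fderiv ℝ F N V i j = 2 * mink (V i) (N j) := fun V i j => by
    have hl : HasDerivAt (fun t : ℝ => N + t • V) V 0 := by
      simpa using ((hasDerivAt_id (0 : ℝ)).smul_const V).const_add N
    have h1 := HasFDerivAt.comp_hasDerivAt (l := F) (0 : ℝ)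
      (by simpa using hs.hasFDerivAt) hl
    have h2 := hasDerivAt_pi.1 (hasDerivAt_pi.1 h1 i) j
    have h3 : HasDerivAt (fun t : ℝ => F N i j + t * (2 * mink (V i) (N j)) +
        t ^ 2 * mink (V i) (V j)) (2 * mink (V i) (N j)) 0 := by
      simpa using (((hasDerivAt_id (0 : ℝ)).mul_const (2 * mink (V i) (N j))).const_add
        (F N i j)).fun_add (((hasDerivAt_id (0 : ℝ)).fun_pow 2).mul_const (mink (V i) (V j)))
    refine h2.unique (h3.congr_of_eventuallyEq (Eventually.of_forall fun t => ?_))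
    simp only [hF, Function.comp, Pi.add_apply, Pi.smul_apply, mink_add_left, mink_add_right,
      mink_smul_left, mink_smul_right]
    ring
  have hsurj : (fderiv ℝ F N : (Fin 4 → Mink) →ₗ[ℝ] Fin 4 → Fin 4 → ℝ).range = ⊤ := by
    rw [LinearMap.range_eq_top]
    intro K
    refine ⟨fun i => ∑ k, (K i k / 2) • dualBasis N k, ?_⟩
    funext i j
    rw [ContinuousLinearMap.coe_coe, hval]
    simp only [mink_sum_left, mink_smul_left, mink_dualBasis hN]
    simp
    ring
  have hmap := hs.map_nhds_eq_of_surj hsurj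
  have hev : ∀ᶠ G in map F (𝓝 N), ∃ N', P N' ∧ F N' = G := by
    rw [eventually_map]
    filter_upwards [hP] with N' h
    exact ⟨N', h, rfl⟩
  rw [hmap] at hev
  have hFN : F N = fun i j => mink (N i) (N j) := by
    funext i j
    simp [hF]
  rw [hFN] at hev
  filter_upwards [hev] with G ⟨N', hPN, hG⟩ hsymm
  refine ⟨N', hPN, fun i j => ?_⟩
  have h1 := congrFun (congrFun hG i) j
  have h2 := congrFun (congrFun hG j) i
  have h3 := hsymm i j
  simp only [hF] at h1 h2
  rw [mink_comm (N' j) (N' i), mink_comm (N' j) (N i), mink_comm (N j) (N' i)] at h2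
  linarith

/-! ### From rays to normalised vertices -/

/-- Vectors which become the vertices of a generalised tetrahedron when they are multiplied by
suitable positive numbers. -/
structure IsPreTetrahedron (u : Fin 4 → Mink) : Prop where
  det_ne_zero : (Matrix.of u).det ≠ 0
  mink_neg : ∀ i j, i ≠ j → mink (u i) (u j) < 0
  mul_lt_sq : ∀ i j, i ≠ j →
    mink (u i) (u i) * mink (u j) (u j) < mink (u i) (u j) ^ 2
  timelike : ∀ i j, i ≠ j → ∃ s > (0 : ℝ), ∃ t > (0 : ℝ),
    mink (s • u i + t • u j) (s • u i + t • u j) < 0 ∧ 0 < (s • u i + t • u j) 0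

theorem GenTetrahedron.isPreTetrahedron (T : GenTetrahedron) : IsPreTetrahedron T.v where
  det_ne_zero := T.det_v_ne_zero
  mink_neg := T.mink_neg
  mul_lt_sq i j hij := by
    have := T.eps_mul_lt_sq hij
    rw [T.mink_v_self, T.mink_v_self]
    linarith
  timelike i j hij := T.exists_timelike hij

theorem continuous_mink : Continuous fun x : Mink × Mink => mink x.1 x.2 := by
  unfold mink
  fun_prop

theorem IsPreTetrahedron.eventually {u : Fin 4 → Mink} (hu : IsPreTetrahedron u) :
    ∀ᶠ u' in 𝓝 u, IsPreTetrahedron u' := by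
  have hm : ∀ i j, Continuous fun u : Fin 4 → Mink => mink (u i) (u j) := fun i j => by
    unfold mink; fun_prop
  have h1 : ∀ᶠ u' : Fin 4 → Mink in 𝓝 u, (Matrix.of u').det ≠ 0 :=
    (contDiffAt_det (k := 0) (A := fun u : Fin 4 → Mink => Matrix.of u) fun i j => by
      simp only [Matrix.of_apply]; fun_prop).continuousAt.eventually_ne hu.det_ne_zero
  have h2 : ∀ i j, ∀ᶠ u' : Fin 4 → Mink in 𝓝 u, i ≠ j → mink (u' i) (u' j) < 0 := fun i j => by
    by_cases hij : i = j
    · simp [hij]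
    filter_upwards [(hm i j).continuousAt.eventually_lt_const (hu.mink_neg i j hij)] with u' h _
      using h
  have h3 : ∀ i j, ∀ᶠ u' : Fin 4 → Mink in 𝓝 u, i ≠ j →
      mink (u' i) (u' i) * mink (u' j) (u' j) < mink (u' i) (u' j) ^ 2 := fun i j => by
    by_cases hij : i = j
    · simp [hij]
    filter_upwards [((hm i i).mul (hm j j)).continuousAt.eventually_lt
      ((hm i j).pow 2).continuousAt (hu.mul_lt_sq i j hij)] with u' h _ using h
  have h4 : ∀ i j, ∀ᶠ u' : Fin 4 → Mink in 𝓝 u, i ≠ j → ∃ s > (0 : ℝ), ∃ t > (0 : ℝ),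
      mink (s • u' i + t • u' j) (s • u' i + t • u' j) < 0 ∧
        0 < (s • u' i + t • u' j) 0 := fun i j => by
    by_cases hij : i = j
    · simp [hij]
    obtain ⟨s, hs, t, ht, hneg, hpos⟩ := hu.timelike i j hij
    have hc : Continuous fun u' : Fin 4 → Mink => s • u' i + t • u' j := by fun_prop
    filter_upwards [(continuous_mink.comp (hc.prodMk hc)).continuousAt.eventually_lt_const hneg,
      ((continuous_apply 0).comp hc).continuousAt.eventually_const_lt hpos] with u' h h' _
    exact ⟨s, hs, t, ht, h, h'⟩
  filter_upwards [h1, eventually_all.2 fun i => eventually_all.2 (h2 i),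
    eventually_all.2 fun i => eventually_all.2 (h3 i),
    eventually_all.2 fun i => eventually_all.2 (h4 i)] with u' k1 k2 k3 k4
  exact ⟨k1, k2, k3, k4⟩

/-- Space-like and time-like vectors have a forced scale; light-like ones may be scaled by a large
C, so that their sum with an ultra-ideal vertex becomes time-like. -/
theorem exists_normalisation (q : Fin 4 → ℝ) {m : Fin 4 → Fin 4 → ℝ}
    (hm : ∀ i j, i ≠ j → m i j < 0) :
    ∃ ρ : Fin 4 → ℝ, (∀ i, 0 < ρ i) ∧ (∀ i, ρ i ^ 2 * q i = (SignType.sign (q i) : ℝ)) ∧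
      ∀ i j, i ≠ j → q i = 0 → q j ≠ 0 → 1 < -(2 * (ρ i * ρ j * m i j)) := by
  set r : Fin 4 → ℝ := fun i => (Real.sqrt |q i|)⁻¹ with hr
  have hrpos : ∀ i, q i ≠ 0 → 0 < r i := fun i h =>
    inv_pos.2 (Real.sqrt_pos.2 (abs_pos.2 h))
  have hC : ∀ᶠ C : ℝ in atTop, 0 < C ∧ ∀ i j, i ≠ j → q j ≠ 0 →
      1 < C * (r j * -(2 * m i j)) := by
    refine (eventually_gt_atTop 0).and (eventually_all.2 fun i => eventually_all.2 fun j => ?_)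
    by_cases h : i ≠ j ∧ q j ≠ 0
    · have hpos : 0 < r j * -(2 * m i j) :=
        mul_pos (hrpos j h.2) (by linarith [hm i j h.1])
      filter_upwards [(tendsto_id.atTop_mul_const hpos).eventually_gt_atTop 1] with C hC _ _
        using hC
    · exact Eventually.of_forall fun C h1 h2 => absurd ⟨h1, h2⟩ h
  obtain ⟨C, hC0, hC⟩ := hC.exists
  refine ⟨fun i => if q i = 0 then C else r i, fun i => ?_, fun i => ?_, fun i j hij hi hj => ?_⟩
  · dsimp only
    split_ifs with h
    exacts [hC0, hrpos i h]
  · dsimp only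
    split_ifs with h
    · simp [h]
    · rw [hr, inv_pow, Real.sq_sqrt (abs_nonneg _), inv_mul_eq_iff_eq_mul₀ (abs_ne_zero.2 h),
        mul_comm, sign_mul_abs]
  · simp only [hi, hj, if_true, if_false]
    linarith [hC i j hij hj]

namespace GenTetrahedron

/-- The outward unit normals are characterised by their products with the vertices. -/
theorem normal_eq_of_mink (T : GenTetrahedron) {N : Fin 4 → Mink} {c : Fin 4 → ℝ}
    (hc : ∀ i, 0 < c i) (hN : ∀ i, mink (N i) (N i) = 1)
    (h : ∀ i j, mink (N i) (T.v j) = if i = j then -c i else 0) : T.normal = N := by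
  have hd : ∀ i, T.dualVec i = (-(c i)⁻¹) • N i := fun i =>
    eq_of_mink_eq T.det_v_ne_zero fun j => by
      rw [mink_dualVec, mink_smul_left, h]
      have := (hc i).ne'
      split_ifs
      · field_simp
      · simp
  funext i
  have hs : T.scale i = (c i)⁻¹ := by
    rw [scale, hd, mink_smul_left, mink_smul_right, hN, mul_one, neg_mul_neg,
      Real.sqrt_mul_self (inv_pos.2 (hc i)).le]
  rw [normal_eq, hs, hd, smul_smul, inv_inv, neg_mul_neg, mul_inv_cancel₀ (hc i).ne', one_smul]

end GenTetrahedron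

theorem IsPreTetrahedron.exists_tetrahedron {u N : Fin 4 → Mink} (hu : IsPreTetrahedron u)
    (hN : ∀ i, mink (N i) (N i) = 1) {c : Fin 4 → ℝ} (hc : ∀ i, 0 < c i)
    (h : ∀ i j, mink (u i) (N j) = if i = j then -c i else 0) :
    ∃ T : GenTetrahedron, T.normal = N := by
  obtain ⟨ρ, hρ, hsign, hlarge⟩ :=
    exists_normalisation (fun i => mink (u i) (u i)) (m := fun i j => mink (u i) (u j)) hu.mink_neg
  have hself : ∀ i, mink (ρ i • u i) (ρ i • u i) = (SignType.sign (mink (u i) (u i)) : ℝ) :=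
    fun i => by
      rw [mink_smul_left, mink_smul_right, ← hsign]
      ring
  have hprod : ∀ i j, mink (ρ i • u i) (ρ j • u j) = ρ i * ρ j * mink (u i) (u j) :=
    fun i j => by
      rw [mink_smul_left, mink_smul_right]
      ring
  have hneg : ∀ i j, i ≠ j → ρ i * ρ j * mink (u i) (u j) < 0 := fun i j hij =>
    mul_neg_of_pos_of_neg (mul_pos (hρ i) (hρ j)) (hu.mink_neg i j hij)
  have hmild : ∀ i j, i ≠ j → 0 < mink (u i) (u i) → 0 < mink (u j) (u j) →
      ρ i * ρ j * mink (u i) (u j) < -1 := fun i j hij hi hj => by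
    have h1 := hsign i
    have h2 := hsign j
    rw [sign_pos hi] at h1
    rw [sign_pos hj] at h2
    -- After normalisation both squares are 1, so the product of the two vectors has square greater
    -- than 1; being negative, it is below −1.
    have h3 := mul_lt_mul_of_pos_left (hu.mul_lt_sq i j hij)
      (mul_pos (pow_pos (hρ i) 2) (pow_pos (hρ j) 2))
    have h4 : ρ i ^ 2 * ρ j ^ 2 * (mink (u i) (u i) * mink (u j) (u j)) =
      (ρ i ^ 2 * mink (u i) (u i)) * (ρ j ^ 2 * mink (u j) (u j)) := by ring
    rw [h4, h1, h2] at h3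
    norm_num at h3
    nlinarith [hneg i j hij]
  have htime : ∀ i j, i ≠ j → mink (ρ i • u i + ρ j • u j) (ρ i • u i + ρ j • u j) < 0 :=
    fun i j hij => by
      have hji := hprod j i
      rw [mink_comm (u j), mul_comm (ρ j)] at hji
      rw [mink_add_left, mink_add_right, mink_add_right, hself, hself, hprod, hji]
      have hn := hneg i j hij
      rcases lt_trichotomy (mink (u i) (u i)) 0 with hi | hi | hi <;>
        rcases lt_trichotomy (mink (u j) (u j)) 0 with hj | hj | hj
      · simp [sign_neg hi, sign_neg hj]; linarith
      · simp [sign_neg hi, hj]; linarith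
      · simp [sign_neg hi, sign_pos hj]; linarith
      · simp [sign_neg hj, hi]; linarith
      · simp [hi, hj]; linarith
      · have := hlarge i j hij hi hj.ne'
        simp [hi, sign_pos hj]; linarith
      · simp [sign_pos hi, sign_neg hj]; linarith
      · have := hlarge j i hij.symm hj hi.ne'
        rw [mink_comm (u j), mul_comm (ρ j)] at this
        simp [sign_pos hi, hj]; linarith
      · have := hmild i j hij hi hj
        simp [sign_pos hi, sign_pos hj]; linarith
  have hkind : ∀ i, -SignType.sign (mink (u i) (u i)) = -1 → 0 < mink (u i) (u i) := fun i hi => by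
    rw [neg_inj, sign_eq_one_iff] at hi
    exact hi
  let T : GenTetrahedron :=
    { v := fun i => ρ i • u i
      kind := fun i => -SignType.sign (mink (u i) (u i))
      mink_self := fun i => by rw [hself]; simp
      indep := linearIndependent_of_mink (u := N) (c := fun i => -(ρ i * c i))
        (fun i => neg_ne_zero.2 (mul_pos (hρ i) (hc i)).ne') fun i j => by
          rw [mink_smul_left, h]
          simp
      mink_neg := fun i j hij => by rw [hprod]; exact hneg i j hij
      mild := fun i j hij hi hj => by
        rw [hprod]; exact hmild i j hij (hkind i hi) (hkind j hj)
      future := fun i j hij => by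
        -- The normalised sum and the known future vector are time-like positive combinations of the
        -- same pair, hence lie in one cone.
        obtain ⟨s, hs, t, ht, h1, h2⟩ := hu.timelike i j hij
        exact future_of_mink_neg h1 (htime i j hij).le
          (mink_combination_neg (hu.mink_neg i j hij) hs ht (hρ i) (hρ j) h1 (htime i j hij)) h2 }
  refine ⟨T, T.normal_eq_of_mink (c := fun i => ρ i * c i) (fun i => mul_pos (hρ i) (hc i)) hN
    fun i j => ?_⟩
  change mink (N i) (ρ j • u j) = _
  rw [mink_smul_right, mink_comm, h]
  by_cases hij : i = j
  · subst hij; simp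
  · simp [hij, Ne.symm hij]

namespace GenTetrahedron

variable (T : GenTetrahedron)

/-- Near the angles of a generalised tetrahedron, all angles are realised. -/
theorem eventually_exists_angles :
    ∀ᶠ a in 𝓝 T.angles, ∃ T' : GenTetrahedron, T'.angles = a := by
  -- This recovers the vertices from the normals. The scales of T are kept for perturbed normals,
  -- since only the rays matter.
  set U : (Fin 4 → Mink) → Fin 4 → Mink := fun N i => (-(T.scale i)⁻¹) • dualBasis N i with hU
  have hdet := T.det_normal_ne_zero
  have hUv : U T.normal = T.v := by
    funext i
    refine eq_of_mink_eq hdet fun j => ?_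
    rw [hU, mink_smul_left, mink_dualBasis hdet, mink_comm, mink_normal_v]
    by_cases hij : i = j
    · subst hij; simp
    · simp [hij, Ne.symm hij]
  have hUc : ContinuousAt U T.normal := by
    refine continuousAt_pi.2 fun i => ContinuousAt.fun_const_smul (continuousAt_pi.2 fun m => ?_) _
    refine ContinuousAt.const_mul ?_ _
    exact (contDiffAt_inv_apply (k := 0) (A := fun u : Fin 4 → Mink => Matrix.of u) (fun i j => by
      simp only [Matrix.of_apply]; fun_prop) hdet m i).continuousAt
  have hdet' : ∀ᶠ N : Fin 4 → Mink in 𝓝 T.normal, (Matrix.of N).det ≠ 0 :=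
    (contDiffAt_det (k := 0) (A := fun u : Fin 4 → Mink => Matrix.of u) fun i j => by
      simp only [Matrix.of_apply]; fun_prop).continuousAt.eventually_ne hdet
  have hpre : ∀ᶠ N in 𝓝 T.normal, IsPreTetrahedron (U N) :=
    hUc.eventually (by rw [hUv]; exact T.isPreTetrahedron.eventually)
  have hev := eventually_exists_gram hdet (hpre.and hdet')
  have hg : Tendsto (fun a => (gramOf a : Fin 4 → Fin 4 → ℝ)) (𝓝 T.angles)
      (𝓝 fun i j => mink (T.normal i) (T.normal j)) := by
    have : (fun i j => mink (T.normal i) (T.normal j)) = (gramOf T.angles : Fin 4 → Fin 4 → ℝ) := by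
      funext i j
      exact (T.gramOf_angles i j).symm
    rw [this]
    exact (continuous_pi fun i => continuous_pi fun j => (contDiff_gramOf i j).continuous).tendsto _
  have hIoo : ∀ᶠ a in 𝓝 T.angles, ∀ e, a e ∈ Set.Ioo 0 Real.pi :=
    eventually_all.2 fun e => (continuous_apply e).continuousAt.eventually_mem
      (isOpen_Ioo.mem_nhds (T.angles_mem_Ioo e))
  filter_upwards [hg.eventually hev, hIoo] with a ha hIoo
  obtain ⟨N, ⟨hN, hNd⟩, hNG⟩ := ha (gramOf_symm a)
  obtain ⟨T', hT'⟩ := hN.exists_tetrahedron (N := N) (c := fun i => (T.scale i)⁻¹)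
    (fun i => by rw [hNG, gramOf_self]) (fun i => inv_pos.2 (T.scale_pos i)) (fun i j => by
      rw [hU, mink_smul_left, mink_dualBasis hNd]
      simp)
  refine ⟨T', funext fun e => ?_⟩
  rw [angles, faceAngle, hT', hNG, gramOf_edge, neg_neg,
    Real.arccos_cos (hIoo e).1.le (hIoo e).2.le]

end GenTetrahedron

/-! ### The theorem -/

theorem mainTheorem1 (T : GenTetrahedron) :
    ∃ U ∈ 𝓝 T.angles, ∃ L : (Fin 6 → ℝ) → (Fin 6 → ℝ),
      -- near the angles of `T`, all six dihedral angles can be prescribed independently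
      (∀ a ∈ U, ∃ T' : GenTetrahedron, T'.angles = a) ∧
      -- and the edge lengths are a function `L` of the dihedral angles
      (∀ T' : GenTetrahedron, T'.angles ∈ U →
        (∀ i, T.kind i ≠ 0 → T'.kind i = T.kind i) ∧
        (∀ e, T.EdgeNoIdeal e → T'.lengths e = L T'.angles e)) ∧
      -- the Jacobian matrix of this function is `-η D S D`
      (T.NoIdeal →
        HasFDerivAt L (Matrix.toLin' T.jacMatrix).toContinuousLinearMap T.angles) ∧
      -- if there are ideal vertices: the gradient of every finite length is the limit of the
      -- corresponding row of `-η D S D` along tetrahedra without ideal vertices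
      (∀ e, T.EdgeNoIdeal e →
        DifferentiableAt ℝ (fun a => L a e) T.angles ∧
        ∀ f, Tendsto (fun T' : GenTetrahedron => T'.jacMatrix e f)
          (comap GenTetrahedron.angles (𝓝 T.angles) ⊓ 𝓟 {T' | T'.NoIdeal})
          (𝓝 (fderiv ℝ (fun a => L a e) T.angles (Pi.single f 1)))) := by
  have hkind : ∀ᶠ a in 𝓝 T.angles, ∀ i, T.kind i ≠ 0 →
      SignType.sign ((gramOf a)⁻¹ i i) = SignType.sign ((gramOf T.angles)⁻¹ i i) := by
    refine eventually_all.2 fun i => ?_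
    by_cases hi : T.kind i = 0
    · simp [hi]
    have h0 := T.inv_gramOf_self_ne_zero hi
    have hc := (contDiffAt_inv_gramOf T.det_gramOf_neg.ne i i).continuousAt
    rcases lt_or_gt_of_ne h0 with h0 | h0
    · filter_upwards [hc.eventually_lt_const h0] with a ha _
      rw [sign_neg ha, sign_neg h0]
    · filter_upwards [hc.eventually_const_lt h0] with a ha _
      rw [sign_pos ha, sign_pos h0]
  have hsign : ∀ (T' : GenTetrahedron) (i : Fin 4),
      SignType.sign ((gramOf T'.angles)⁻¹ i i) = -T'.kind i := fun T' i => by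
    rw [T'.inv_gramOf_self]
    have := pow_pos (T'.scale_pos i) 2
    rcases T'.kind_cases i with h | h | h
    · rw [T'.eps_of_kind_one h, h, sign_neg (by linarith)]
    · rw [T'.eps_of_kind_zero h, h]; simp
    · rw [T'.eps_of_kind_neg_one h, h, sign_pos (by linarith)]; rfl
  refine ⟨_, T.eventually_exists_angles.and hkind, lenOf, fun a ha => ha.1, fun T' hT' => ?_,
    fun h => T.hasFDerivAt_lenOf h, fun e he => ⟨?_, fun f => ?_⟩⟩
  · have hk : ∀ i, T.kind i ≠ 0 → T'.kind i = T.kind i := fun i hi => by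
      have := hT'.2 i hi
      rwa [hsign, hsign, neg_inj] at this
    refine ⟨hk, fun e he => T'.lengths_eq_lenOf ⟨?_, ?_⟩⟩
    · rw [hk _ he.1]; exact he.1
    · rw [hk _ he.2]; exact he.2
  · exact (T.contDiffAt_lenOf he).differentiableAt one_ne_zero
  -- `lenOf` is C¹ at these angles although other vertices may be ideal, so its gradient is
  -- continuous there; at tetrahedra without ideal vertices the gradient is the row of −η D S D.
  · have hc : ContinuousAt (fun a => fderiv ℝ (fun a => lenOf a e) a (Pi.single f 1)) T.angles :=
      ((T.contDiffAt_lenOf he).continuousAt_fderiv one_ne_zero).clm_apply continuousAt_const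
    refine ((hc.tendsto.comp tendsto_comap).mono_left inf_le_left).congr' ?_
    filter_upwards [mem_inf_of_right (mem_principal_self _)] with T' hT'
    exact (T'.jacMatrix_apply hT' e f).symm

end
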